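/- Let $T_{HO}$ be the harmonic oscillator in the complex Hilbert space $L^2(\mathbb{R})$, that is, the maximally defined operator associated with $\tau_{HO} = -\frac{d^2}{dx^2} + x^2$: $T_{HO} f = \tau_{HO} f$ for $f \in \operatorname{dom}(T_{HO}) = \{ g \in L^2(\mathbb{R}) \mid g, g' \in AC_{loc}(\mathbb{R}),\ \tau_{HO}\, g \in L^2(\mathbb{R}) \}$. Let $X$ be the maximally defined operator of multiplication by the independent variable in $L^2(\mathbb{R})$, $(Xf)(x) = x f(x)$, $\operatorname{dom}(X) = \{ g \in L^2(\mathbb{R}) \mid x g \in L^2(\mathbb{R}) \}$. Powers of an unbounded operator $A$ are defined on their natural domains, $A^0 = I$ and $\operatorname{dom}(A^{n+1}) = \{ f \in \operatorname{dom}(A^n) \mid A^n f \in \operatorname{dom}(A) \}$, $A^{n+1} f = A (A^n f)$. For $s \geq 0$ let $H^s(\mathbb{R}) = \{ f \in L^2(\mathbb{R}) \mid \int_{\mathbb{R}} (1+|\xi|^2)^s |\widehat f(\xi)|^2 \, d\xi < \infty \}$ denote the usual $L^2$-based Sobolev space. Then, for every positive integer $k$, $$\operatorname{dom}\big(T_{HO}^k\big)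 = H^{2k}(\mathbb{R}) \cap \operatorname{dom}\big(X^{2k}\big).$$ -/

import Mathlib

open MeasureTheory Set

namespace HarmonicOscillator

/-- The complex Hilbert space `L²(ℝ)` (Lebesgue measure). -/
abbrev L2 : Type := Lp (α := ℝ) ℂ 2 (volume : Measure ℝ)

/-! ### Partially defined operators: composition and powers -/

/-- The composition `A B` of two unbounded operators, with its natural maximal domain
`{f ∈ dom B | B f ∈ dom A}`. -/
def compOp {E : Type*} [AddCommGroup E] [Module ℂ E] (A B : E →ₗ.[ℂ] E) : E →ₗ.[ℂ] E :=
  A.comp (B.domRestrict ((A.domain.comap B.toFun).map B.domain.subtype)) (by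
    rintro ⟨x, ⟨y, hy, rfl⟩, hx⟩
    exact hy)

theorem mem_compOp_domain {E : Type*} [AddCommGroup E] [Module ℂ E] (A B : E →ₗ.[ℂ] E) (f : E) :
    f ∈ (compOp A B).domain ↔ ∃ h : f ∈ B.domain, B ⟨f, h⟩ ∈ A.domain := by
  constructor
  · rintro ⟨⟨y, hy, rfl⟩, hx⟩
    exact ⟨hx, hy⟩
  · rintro ⟨h, h'⟩
    exact ⟨⟨⟨f, h⟩, h', rfl⟩, h⟩

theorem compOp_apply {E : Type*} [AddCommGroup E] [Module ℂ E] (A B : E →ₗ.[ℂ] E) (f : E)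
    (h : f ∈ B.domain) (h' : B ⟨f, h⟩ ∈ A.domain) :
    compOp A B ⟨f, (mem_compOp_domain A B f).2 ⟨h, h'⟩⟩ = A ⟨B ⟨f, h⟩, h'⟩ :=
  rfl

/-- The powers of an unbounded operator: `A ^ 0 = I` (everywhere defined) and
`A ^ (n + 1) = A A ^ n`, with domain `{f ∈ dom (A ^ n) | A ^ n f ∈ dom A}`. -/
noncomputable def powOp {E : Type*} [AddCommGroup E] [Module ℂ E] (A : E →ₗ.[ℂ] E) :
    ℕ → (E →ₗ.[ℂ] E)
  | 0 => (LinearMap.id : E →ₗ[ℂ] E).toPMap ⊤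
  | n + 1 => compOp A (powOp A n)

/-! ### The position operator -/

/-- The maximally defined operator `X` of multiplication by the independent variable in `L²(ℝ)`:
`dom X = {f ∈ L²(ℝ) | x f ∈ L²(ℝ)}` and `(X f)(x) = x f(x)`. -/
noncomputable def opX : L2 →ₗ.[ℂ] L2 where
  domain :=
    { carrier := {f | MemLp (fun x : ℝ => (x : ℂ) * f x) 2 volume}
      zero_mem' := by
        refine (MemLp.zero (ε := ℂ)).ae_eq ?_
        filter_upwards [Lp.coeFn_zero ℂ 2 (volume : Measure ℝ)] with x hx
        simp
      add_mem' := by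
        intro f g hf hg
        refine (MemLp.add hf hg).ae_eq ?_
        filter_upwards [Lp.coeFn_add f g] with x hx
        simp only [Pi.add_apply, hx, mul_add]
      smul_mem' := by
        intro c f hf
        refine (MemLp.const_smul hf c).ae_eq ?_
        filter_upwards [Lp.coeFn_smul c f] with x hx
        simp only [Pi.smul_apply, smul_eq_mul, hx]
        ring }
  toFun :=
    { toFun := fun f => MemLp.toLp _ f.2
      map_add' := by
        intro f g
        rw [← MemLp.toLp_add]
        refine MemLp.toLp_congr _ _ ?_
        filter_upwards [Lp.coeFn_add (f : L2) (g : L2)] with x hx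
        simp only [Submodule.coe_add, Pi.add_apply, hx, mul_add]
      map_smul' := by
        intro c f
        rw [RingHom.id_apply, ← MemLp.toLp_const_smul]
        refine MemLp.toLp_congr _ _ ?_
        filter_upwards [Lp.coeFn_smul c (f : L2)] with x hx
        simp only [Pi.smul_apply, smul_eq_mul, SetLike.val_smul, hx]
        ring }

/-! ### The harmonic oscillator -/

/-- `g ∈ AC_loc(ℝ)`: absolute continuity on every compact interval. -/
def LocAC (g : ℝ → ℂ) : Prop :=
  ∀ a b : ℝ, AbsolutelyContinuousOnInterval g a b

theorem LocAC.add {g h : ℝ → ℂ} (hg : LocAC g) (hh : LocAC h) : LocAC (g + h) :=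
  fun a b => (hg a b).add (hh a b)

theorem LocAC.const_smul {g : ℝ → ℂ} (c : ℂ) (hg : LocAC g) : LocAC (c • g) :=
  fun a b => (hg a b).const_smul c

theorem LocAC.continuous {g : ℝ → ℂ} (hg : LocAC g) : Continuous g := by
  rw [continuous_iff_continuousAt]
  intro x
  refine ((hg (x - 1) (x + 1)).continuousOn).continuousAt ?_
  rw [uIcc_of_le (by linarith)]
  exact Icc_mem_nhds (by linarith) (by linarith)

/-- A locally absolutely continuous function is differentiable almost everywhere. -/
theorem LocAC.ae_differentiableAt {g : ℝ → ℂ} (hg : LocAC g) :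
    ∀ᵐ x : ℝ, DifferentiableAt ℝ g x := by
  have key : ∀ n : ℕ, ∀ᵐ x : ℝ, x ∈ uIcc (-(n : ℝ)) n → DifferentiableAt ℝ g x := by
    intro n
    have h := hg (-(n : ℝ)) n
    filter_upwards [h.boundedVariationOn.ae_differentiableAt_of_mem_uIcc] with x hx using hx
  filter_upwards [ae_all_iff.2 key] with x hx
  obtain ⟨n, hn⟩ := exists_nat_ge |x|
  refine hx n ?_
  rw [uIcc_of_le (by linarith [abs_nonneg x])]
  exact abs_le.1 hn

/-- If `g` and its (almost everywhere defined) derivative are locally absolutely continuous, then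
`g` is differentiable at every point. -/
theorem LocAC.differentiable {g : ℝ → ℂ} (hg : LocAC g) (hg' : LocAC (deriv g)) :
    Differentiable ℝ g := by
  have hc := hg'.continuous
  set h : ℝ → ℂ := fun x => ∫ t in (0 : ℝ)..x, deriv g t with hh
  have hd : ∀ x, HasDerivAt h (deriv g x) x := fun x =>
    intervalIntegral.integral_hasDerivAt_right (hc.intervalIntegrable _ _)
      (hc.stronglyMeasurableAtFilter _ _) hc.continuousAt
  have hC : ContDiff ℝ 1 h := by
    rw [contDiff_one_iff_deriv]
    refine ⟨fun x => (hd x).differentiableAt, ?_⟩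
    have : deriv h = deriv g := funext fun x => (hd x).deriv
    rw [this]
    exact hc
  have hconst : ∀ x, (g - h) x = (g - h) 0 := by
    intro x
    have hac : AbsolutelyContinuousOnInterval (g - h) 0 x :=
      (hg 0 x).sub hC.contDiffOn.absolutelyContinuousOnInterval
    obtain ⟨C, hC'⟩ := hac.const_of_ae_hasDerivAt_zero (by
      filter_upwards [hg.ae_differentiableAt] with y hy _
      simpa using hy.hasDerivAt.sub (hd y))
    rw [hC' x right_mem_uIcc, hC' 0 left_mem_uIcc]
  have hfun : g = fun x => h x + (g - h) 0 := by
    funext x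
    rw [← hconst x]
    simp
  rw [hfun]
  exact fun x => ((hd x).differentiableAt).add_const _

/-- The harmonic oscillator differential expression `τ g = -g'' + x² g`. -/
noncomputable def tau (g : ℝ → ℂ) (x : ℝ) : ℂ :=
  -deriv (deriv g) x + (x : ℂ) ^ 2 * g x

/-- `g` is a representative of the class `f ∈ L²(ℝ)` with `g, g' ∈ AC_loc(ℝ)` and
`τ g ∈ L²(ℝ)`. -/
structure IsDomRep (f : L2) (g : ℝ → ℂ) : Prop where
  ae_eq : f =ᵐ[volume] g
  ac : LocAC g
  ac_deriv : LocAC (deriv g)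
  memLp : MemLp (tau g) 2 volume

theorem IsDomRep.unique {f : L2} {g h : ℝ → ℂ} (hg : IsDomRep f g) (hh : IsDomRep f h) : g = h :=
  (hg.ac.continuous.ae_eq_iff_eq volume hh.ac.continuous).1 (hg.ae_eq.symm.trans hh.ae_eq)

theorem deriv_add_eq {g h : ℝ → ℂ} (hg : Differentiable ℝ g) (hh : Differentiable ℝ h) :
    deriv (g + h) = deriv g + deriv h :=
  funext fun x => deriv_add (hg x) (hh x)

theorem deriv_smul_eq {g : ℝ → ℂ} (c : ℂ) (hg : Differentiable ℝ g) :
    deriv (c • g) = c • deriv g :=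
  funext fun x => deriv_const_smul c (hg x)

theorem tau_add {g h : ℝ → ℂ} (hg : LocAC g) (hg' : LocAC (deriv g)) (hh : LocAC h)
    (hh' : LocAC (deriv h)) : tau (g + h) =ᵐ[volume] tau g + tau h := by
  filter_upwards [hg'.ae_differentiableAt, hh'.ae_differentiableAt] with x hx hy
  simp only [tau, deriv_add_eq (hg.differentiable hg') (hh.differentiable hh'), deriv_add hx hy,
    Pi.add_apply]
  ring

theorem tau_smul {g : ℝ → ℂ} (c : ℂ) (hg : LocAC g) (hg' : LocAC (deriv g)) :
    tau (c • g) =ᵐ[volume] c • tau g := by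
  filter_upwards [hg'.ae_differentiableAt] with x hx
  simp only [tau, deriv_smul_eq c (hg.differentiable hg'), deriv_const_smul c hx,
    Pi.smul_apply, smul_eq_mul]
  ring

theorem IsDomRep.add {f f' : L2} {g h : ℝ → ℂ} (hg : IsDomRep f g) (hh : IsDomRep f' h) :
    IsDomRep (f + f') (g + h) where
  ae_eq := (Lp.coeFn_add f f').trans (hg.ae_eq.add hh.ae_eq)
  ac := hg.ac.add hh.ac
  ac_deriv := by
    rw [deriv_add_eq (hg.ac.differentiable hg.ac_deriv) (hh.ac.differentiable hh.ac_deriv)]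
    exact hg.ac_deriv.add hh.ac_deriv
  memLp := (hg.memLp.add hh.memLp).ae_eq (tau_add hg.ac hg.ac_deriv hh.ac hh.ac_deriv).symm

theorem IsDomRep.smul {f : L2} {g : ℝ → ℂ} (c : ℂ) (hg : IsDomRep f g) :
    IsDomRep (c • f) (c • g) where
  ae_eq := (Lp.coeFn_smul c f).trans (hg.ae_eq.const_smul c)
  ac := hg.ac.const_smul c
  ac_deriv := by
    rw [deriv_smul_eq c (hg.ac.differentiable hg.ac_deriv)]
    exact hg.ac_deriv.const_smul c
  memLp := (hg.memLp.const_smul c).ae_eq (tau_smul c hg.ac hg.ac_deriv).symm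

theorem isDomRep_zero : IsDomRep 0 0 where
  ae_eq := Lp.coeFn_zero ℂ 2 volume
  ac := fun a b => contDiff_const.contDiffOn.absolutelyContinuousOnInterval
  ac_deriv := by
    have h : deriv (0 : ℝ → ℂ) = 0 := funext fun x => deriv_const x 0
    rw [h]
    exact fun a b => contDiff_const.contDiffOn.absolutelyContinuousOnInterval
  memLp := by
    have h : deriv (0 : ℝ → ℂ) = 0 := funext fun x => deriv_const x 0
    have h' : tau 0 = 0 := by
      funext x
      simp [tau, h]
    rw [h']
    exact MemLp.zero

/-- The harmonic oscillator in `L²(ℝ)`: the maximally defined operator of the differential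
expression `τ`, that is `T_HO f = τ f` on
`dom T_HO = {g ∈ L²(ℝ) | g, g' ∈ AC_loc(ℝ), τ g ∈ L²(ℝ)}`. -/
noncomputable def opHO : L2 →ₗ.[ℂ] L2 where
  domain :=
    { carrier := {f | ∃ g : ℝ → ℂ, IsDomRep f g}
      zero_mem' := ⟨0, isDomRep_zero⟩
      add_mem' := by
        rintro _ _ ⟨g, hg⟩ ⟨h, hh⟩
        exact ⟨g + h, hg.add hh⟩
      smul_mem' := by
        rintro c _ ⟨g, hg⟩
        exact ⟨c • g, hg.smul c⟩ }
  toFun :=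
    { toFun := fun f => MemLp.toLp (tau f.2.choose) f.2.choose_spec.memLp
      map_add' := by
        intro f f'
        have h := (f + f').2.choose_spec.unique (f.2.choose_spec.add f'.2.choose_spec)
        rw [← MemLp.toLp_add]
        refine MemLp.toLp_congr _ _ ?_
        rw [h]
        exact tau_add f.2.choose_spec.ac f.2.choose_spec.ac_deriv f'.2.choose_spec.ac
          f'.2.choose_spec.ac_deriv
      map_smul' := by
        intro c f
        have h := (c • f).2.choose_spec.unique (f.2.choose_spec.smul c)
        rw [RingHom.id_apply, ← MemLp.toLp_const_smul]
        refine MemLp.toLp_congr _ _ ?_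
        rw [h]
        exact tau_smul c f.2.choose_spec.ac f.2.choose_spec.ac_deriv }

/-- The value of `T_HO` does not depend on a choice: `T_HO f = τ g` for the (unique) representative
`g` of `f` with `g, g' ∈ AC_loc(ℝ)`. -/
theorem opHO_apply {f : L2} {g : ℝ → ℂ} (hg : IsDomRep f g) :
    opHO ⟨f, ⟨g, hg⟩⟩ = MemLp.toLp (tau g) hg.memLp := by
  have hf : ∃ g : ℝ → ℂ, IsDomRep f g := ⟨g, hg⟩
  have h : hf.choose = g := hf.choose_spec.unique hg
  change MemLp.toLp (tau hf.choose) hf.choose_spec.memLp = _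
  refine MemLp.toLp_congr _ _ ?_
  rw [h]

/-! ### Sobolev spaces -/

/-- The Sobolev space `H^s(ℝ)`, `s ≥ 0`, as a subspace of `L²(ℝ)`: all `f ∈ L²(ℝ)` with
`(1 + |ξ|²) ^ (s / 2) 𝓕 f ∈ L²(ℝ)`, equivalently `∫ (1 + |ξ|²) ^ s |𝓕 f (ξ)|² dξ < ∞`. The
normalization of the Fourier transform does not affect the space. -/
def sobolevH (s : ℝ) : Submodule ℂ L2 where
  carrier := {f | TemperedDistribution.MemSobolev s 2 (Lp.toTemperedDistribution f)}
  zero_mem' := by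
    rw [mem_ofPred_eq, ← Lp.toTemperedDistributionCLM_apply, map_zero]
    exact TemperedDistribution.memSobolev_fun_zero ℝ ℂ s 2
  add_mem' := by
    intro f g hf hg
    rw [mem_ofPred_eq, ← Lp.toTemperedDistributionCLM_apply, map_add]
    exact TemperedDistribution.MemSobolev.add hf hg
  smul_mem' := by
    intro c f hf
    rw [mem_ofPred_eq, ← Lp.toTemperedDistributionCLM_apply, map_smul]
    exact TemperedDistribution.MemSobolev.smul c hf

end HarmonicOscillator

/-!
Both sides are identified with the weighted Sobolev class of order `2 k`: the functions which every
product of at most `2 k` factors `x` and `d/dx`, in any order, maps into `L²(ℝ)`.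

For the powers of the oscillator this is elliptic regularity. If `f` and `g = -f'' + x² f` are in
`L²`, testing the equation with `χ f` and then with `χ x² f`, for cutoffs `χ` tending to `1`, bounds
`f'`, `x f`, and then `f''`, `x f'`, `x² f` in `L²` (`weightedSobolev_two`). Since `d/dx` and `x`
commute with the oscillator up to lower order, applying the statement for `g` of order `m` to `f'`
and to `x f` gives it for order `m + 1` (`WeightedSobolev.of_oscillator`), and peeling off one
factor at a time gives `mem_powOp_opHO_domain`.

For the other side, membership in `H ^ n` amounts to having `n` successive weak derivatives in `L²`
(`mem_sobolevH_succ`, through the lemma of du Bois-Reymond), and the mixed products `xᵃ f⁽ᵇ⁾` with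
`a + b ≤ n` are controlled by interpolation between `xⁿ f` and `f⁽ⁿ⁾`: with
`w = (1 + x²) / (1 + ε x²)`, the quantities `∫ w ^ (n - b) |f⁽ᵇ⁾|²` are finite and, integrating by
parts, convex in `b` up to small and lower order terms (`weighted_norm_convexity`). Hence they are
bounded uniformly in `ε` (`bounded_of_almost_convex`), and Fatou's lemma concludes
(`integrable_one_add_sq_pow_mul_of_add_le`).

Weak derivatives are understood through locally absolutely continuous representatives, and all
integrations by parts come from the vanishing of the integral of an integrable weak derivative of an
integrable function (`HasWeakDeriv.integral_eq_zero`).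
-/

namespace HarmonicOscillator

open Filter Topology ComplexConjugate

/-! ### Locally absolutely continuous functions -/

theorem absolutelyContinuousOnInterval_clm_comp {E F : Type*} [NormedAddCommGroup E]
    [NormedSpace ℝ E] [NormedAddCommGroup F] [NormedSpace ℝ F] (L : E →L[ℝ] F) {g : ℝ → E}
    {a b : ℝ} (hg : AbsolutelyContinuousOnInterval g a b) :
    AbsolutelyContinuousOnInterval (fun x => L (g x)) a b := by
  refine squeeze_zero (fun t => Finset.sum_nonneg fun i _ => dist_nonneg) (fun t => ?_)
    (by simpa using Tendsto.const_mul ‖L‖ hg)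
  rw [Finset.mul_sum]
  exact Finset.sum_le_sum fun i _ => L.dist_le_opNorm _ _

theorem LocAC.mul {g h : ℝ → ℂ} (hg : LocAC g) (hh : LocAC h) : LocAC (g * h) :=
  fun a b => (hg a b).smul (hh a b)

theorem LocAC.clm_comp (L : ℂ →L[ℝ] ℂ) {g : ℝ → ℂ} (hg : LocAC g) : LocAC fun x => L (g x) :=
  fun a b => absolutelyContinuousOnInterval_clm_comp L (hg a b)

theorem LocAC.of_hasDerivAt {g g' : ℝ → ℂ} (h : ∀ x, HasDerivAt g (g' x) x) (hc : Continuous g') :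
    LocAC g := by
  have : ContDiff ℝ 1 g := by
    rw [contDiff_one_iff_deriv]
    refine ⟨fun x => (h x).differentiableAt, ?_⟩
    rwa [funext fun x => (h x).deriv]
  exact fun a b => this.contDiffOn.absolutelyContinuousOnInterval

theorem LocAC.ae_hasDerivAt_clm {g : ℝ → ℂ} (hg : LocAC g) (L : ℂ →L[ℝ] ℝ) :
    ∀ᵐ x, HasDerivAt (fun x => L (g x)) (L (deriv g x)) x := by
  filter_upwards [hg.ae_differentiableAt] with x hx
  exact L.hasFDerivAt.comp_hasDerivAt x hx.hasDerivAt

theorem LocAC.intervalIntegrable_clm {g : ℝ → ℂ} (hg : LocAC g) (L : ℂ →L[ℝ] ℝ) (a b : ℝ) :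
    IntervalIntegrable (fun x => L (deriv g x)) volume a b := by
  refine (absolutelyContinuousOnInterval_clm_comp L (hg a b)).intervalIntegrable_deriv.congr_ae ?_
  filter_upwards [ae_restrict_of_ae (hg.ae_hasDerivAt_clm L)] with x hx using hx.deriv

theorem LocAC.intervalIntegrable_deriv {g : ℝ → ℂ} (hg : LocAC g) (a b : ℝ) :
    IntervalIntegrable (deriv g) volume a b := by
  have h1 := hg.intervalIntegrable_clm Complex.reCLM a b
  have h2 := hg.intervalIntegrable_clm Complex.imCLM a b
  rw [intervalIntegrable_iff] at *
  have := h1.ofReal (𝕜 := ℂ).add (h2.ofReal (𝕜 := ℂ).mul_const Complex.I)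
  refine this.congr (Eventually.of_forall fun x => ?_)
  simp [Complex.re_add_im]

theorem LocAC.integral_deriv {g : ℝ → ℂ} (hg : LocAC g) (a b : ℝ) :
    ∫ x in a..b, deriv g x = g b - g a := by
  have key : ∀ L : ℂ →L[ℝ] ℝ, L (∫ x in a..b, deriv g x) = L (g b - g a) := by
    intro L
    rw [← L.intervalIntegral_comp_comm (hg.intervalIntegrable_deriv a b), map_sub,
      ← (absolutelyContinuousOnInterval_clm_comp L (hg a b)).integral_deriv_eq_sub]
    refine intervalIntegral.integral_congr_ae ?_
    filter_upwards [hg.ae_hasDerivAt_clm L] with x hx _ using hx.deriv.symm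
  exact Complex.ext (key Complex.reCLM) (key Complex.imCLM)

/-- The primitive of a locally integrable function is locally absolutely continuous. -/
theorem LocAC.primitive {g : ℝ → ℂ} (hg : LocallyIntegrable g) :
    LocAC fun x => ∫ t in (0 : ℝ)..x, g t := by
  have hi : ∀ a b, IntervalIntegrable g volume a b := fun a b =>
    intervalIntegrable_iff.mpr <|
      (hg.integrableOn_isCompact isCompact_uIcc).mono_set uIoc_subset_uIcc
  have key : ∀ (L : ℂ →L[ℝ] ℝ) (a b : ℝ),
      AbsolutelyContinuousOnInterval (fun x => L (∫ t in (0 : ℝ)..x, g t)) a b := by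
    intro L a b
    have hL : IntervalIntegrable (fun x => L (g x)) volume (min a (min b 0)) (max a (max b 0)) := by
      have := hi (min a (min b 0)) (max a (max b 0))
      rw [intervalIntegrable_iff] at *
      exact L.integrable_comp this
    have h0 := hL.absolutelyContinuousOnInterval_intervalIntegral (c := 0) (by
      rw [mem_uIcc]; left; simp)
    simp only [← L.intervalIntegral_comp_comm (hi 0 _)]
    refine h0.mono ?_
    rw [uIcc_subset_uIcc_iff_mem, mem_uIcc, mem_uIcc]
    constructor <;> left <;> simp
  intro a b
  have h1 := absolutelyContinuousOnInterval_clm_comp Complex.ofRealCLM (key Complex.reCLM a b)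
  have h2 := (absolutelyContinuousOnInterval_clm_comp Complex.ofRealCLM
    (key Complex.imCLM a b)).const_smul Complex.I
  have e : (fun x => ∫ t in (0 : ℝ)..x, g t) =
      (fun x => Complex.ofRealCLM (Complex.reCLM (∫ t in (0 : ℝ)..x, g t))) +
        fun x => Complex.I • Complex.ofRealCLM (Complex.imCLM (∫ t in (0 : ℝ)..x, g t)) := by
    funext x
    simp [mul_comm Complex.I, Complex.re_add_im]
  rw [e]
  exact h1.add h2

/-- A locally absolutely continuous function whose derivative agrees almost everywhere with a
continuous function is differentiable everywhere, with that derivative. -/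
theorem LocAC.hasDerivAt_of_ae {g g' : ℝ → ℂ} (hg : LocAC g) (h : deriv g =ᵐ[volume] g')
    (hc : Continuous g') (x : ℝ) : HasDerivAt g (g' x) x := by
  have hg' : g = fun x => (∫ t in (0 : ℝ)..x, g' t) + g 0 := by
    funext y
    rw [← intervalIntegral.integral_congr_ae (h.mono fun t ht _ => ht), hg.integral_deriv]
    ring
  rw [hg']
  exact (intervalIntegral.integral_hasDerivAt_right (hc.intervalIntegrable _ _)
      (hc.stronglyMeasurableAtFilter _ _) hc.continuousAt).add_const _

/-! ### Weak derivatives -/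

/-- `g'` is the weak derivative of `g`: almost everywhere, `g` agrees with a locally absolutely
continuous function and `g'` with the derivative of that function. The notion depends only on the
almost everywhere classes of `g` and `g'`. -/
def HasWeakDeriv (g g' : ℝ → ℂ) : Prop :=
  ∃ h : ℝ → ℂ, LocAC h ∧ g =ᵐ[volume] h ∧ deriv h =ᵐ[volume] g'

theorem HasWeakDeriv.congr {f f' g g' : ℝ → ℂ} (h : HasWeakDeriv f f') (h1 : f =ᵐ[volume] g)
    (h2 : f' =ᵐ[volume] g') : HasWeakDeriv g g' := by
  obtain ⟨u, hu, hfu, hu'⟩ := h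
  exact ⟨u, hu, h1.symm.trans hfu, hu'.trans h2⟩

theorem HasWeakDeriv.unique {f f' f'' : ℝ → ℂ} (h : HasWeakDeriv f f') (h' : HasWeakDeriv f f'') :
    f' =ᵐ[volume] f'' := by
  obtain ⟨u, hu, hfu, hu'⟩ := h
  obtain ⟨v, hv, hfv, hv'⟩ := h'
  have : u = v := (hu.continuous.ae_eq_iff_eq volume hv.continuous).1 (hfu.symm.trans hfv)
  subst this
  exact hu'.symm.trans hv'

theorem HasWeakDeriv.of_hasDerivAt {g g' : ℝ → ℂ} (h : ∀ x, HasDerivAt g (g' x) x)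
    (hc : Continuous g') : HasWeakDeriv g g' :=
  ⟨g, LocAC.of_hasDerivAt h hc, EventuallyEq.rfl,
    Eventually.of_forall fun x => (h x).deriv⟩

theorem HasWeakDeriv.ae_eq_continuous {f f' : ℝ → ℂ} (h : HasWeakDeriv f f') :
    ∃ u : ℝ → ℂ, Continuous u ∧ f =ᵐ[volume] u := by
  obtain ⟨u, hu, hfu, _⟩ := h
  exact ⟨u, hu.continuous, hfu⟩

theorem HasWeakDeriv.aestronglyMeasurable_deriv {f f' : ℝ → ℂ} (h : HasWeakDeriv f f') :
    AEStronglyMeasurable f' volume := by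
  obtain ⟨u, hu, _, hu'⟩ := h
  exact (_root_.aestronglyMeasurable_deriv u volume).congr hu'

theorem HasWeakDeriv.add {f f' g g' : ℝ → ℂ} (hf : HasWeakDeriv f f') (hg : HasWeakDeriv g g') :
    HasWeakDeriv (fun x => f x + g x) fun x => f' x + g' x := by
  obtain ⟨u, hu, hfu, hu'⟩ := hf
  obtain ⟨v, hv, hgv, hv'⟩ := hg
  refine ⟨u + v, hu.add hv, hfu.add hgv, ?_⟩
  filter_upwards [hu', hv', hu.ae_differentiableAt, hv.ae_differentiableAt] with x h1 h2 h3 h4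
  rw [deriv_add h3 h4, h1, h2]

theorem HasWeakDeriv.mul {f f' g g' : ℝ → ℂ} (hf : HasWeakDeriv f f') (hg : HasWeakDeriv g g') :
    HasWeakDeriv (fun x => f x * g x) fun x => f' x * g x + f x * g' x := by
  obtain ⟨u, hu, hfu, hu'⟩ := hf
  obtain ⟨v, hv, hgv, hv'⟩ := hg
  refine ⟨u * v, hu.mul hv, hfu.mul hgv, ?_⟩
  filter_upwards [hu', hv', hu.ae_differentiableAt, hv.ae_differentiableAt, hfu, hgv]
    with x h1 h2 h3 h4 h5 h6
  rw [deriv_mul h3 h4, h1, h2, h5, h6]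

theorem HasWeakDeriv.const_mul {f f' : ℝ → ℂ} (hf : HasWeakDeriv f f') (c : ℂ) :
    HasWeakDeriv (fun x => c * f x) fun x => c * f' x := by
  have hc : HasWeakDeriv (fun _ => c) fun _ => 0 :=
    .of_hasDerivAt (fun x => hasDerivAt_const x c) continuous_const
  simpa using hc.mul hf

theorem HasWeakDeriv.conj {f f' : ℝ → ℂ} (hf : HasWeakDeriv f f') :
    HasWeakDeriv (fun x => conj (f x)) fun x => conj (f' x) := by
  obtain ⟨u, hu, hfu, hu'⟩ := hf
  refine ⟨_, hu.clm_comp (Complex.conjCLE : ℂ →L[ℝ] ℂ), hfu.fun_comp conj, ?_⟩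
  filter_upwards [hu', hu.ae_differentiableAt] with x h1 h2
  rw [← h1]
  exact ((Complex.conjCLE : ℂ →L[ℝ] ℂ).hasFDerivAt.comp_hasDerivAt x h2.hasDerivAt).deriv

theorem HasWeakDeriv.id_mul {f f' : ℝ → ℂ} (hf : HasWeakDeriv f f') :
    HasWeakDeriv (fun x => (x : ℂ) * f x) fun x => f x + (x : ℂ) * f' x := by
  have hx : HasWeakDeriv (fun x : ℝ => (x : ℂ)) fun _ => 1 :=
    .of_hasDerivAt (fun x => (hasDerivAt_id x).ofReal_comp) continuous_const
  simpa using hx.mul hf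

/-- The integral over the line of an integrable weak derivative of an integrable function
vanishes: the function has limits at `±∞`, which must be zero. -/
theorem HasWeakDeriv.integral_eq_zero {f f' : ℝ → ℂ} (h : HasWeakDeriv f f') (hf : Integrable f)
    (hf' : Integrable f') : ∫ x, f' x = 0 := by
  obtain ⟨u, hu, hfu, hu'⟩ := h
  replace hf := hf.congr hfu
  rw [← integral_congr_ae hu']
  replace hf' := hf'.congr hu'.symm
  have htop : Tendsto u atTop (𝓝 0) := by
    have h1 : Tendsto u atTop (𝓝 ((∫ x in Ioi 0, deriv u x) + u 0)) := by
      refine ((intervalIntegral_tendsto_integral_Ioi 0 hf'.integrableOn tendsto_id).add_const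
        (u 0)).congr fun x => ?_
      rw [hu.integral_deriv]
      simp
    have h2 := (hf.integrableAtFilter atTop).eq_zero_of_tendsto (fun s hs => by
      obtain ⟨b, hb⟩ := mem_atTop_sets.1 hs
      rw [← top_le_iff, ← Real.volume_Ici (a := b)]
      exact measure_mono hb) h1
    rwa [h2] at h1
  have hbot : Tendsto u atBot (𝓝 0) := by
    have h1 : Tendsto u atBot (𝓝 (u 0 - ∫ x in Iic 0, deriv u x)) := by
      refine ((intervalIntegral_tendsto_integral_Iic 0 hf'.integrableOn tendsto_id).const_sub
        (u 0)).congr fun x => ?_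
      rw [hu.integral_deriv]
      simp
    have h2 := (hf.integrableAtFilter atBot).eq_zero_of_tendsto (fun s hs => by
      obtain ⟨b, hb⟩ := mem_atBot_sets.1 hs
      rw [← top_le_iff, ← Real.volume_Iic (a := b)]
      exact measure_mono hb) h1
    rwa [h2] at h1
  refine tendsto_nhds_unique
    (intervalIntegral_tendsto_integral hf' tendsto_neg_atTop_atBot tendsto_id) ?_
  simp only [hu.integral_deriv]
  simpa using htop.sub (hbot.comp tendsto_neg_atTop_atBot)

/-! ### Weighted Sobolev classes -/

/-- `f` has weighted Sobolev regularity of order `m`: every product of at most `m` factors, each a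
multiplication by `x` or a weak differentiation, maps `f` into `L²(ℝ)`. -/
def WeightedSobolev : ℕ → (ℝ → ℂ) → Prop
  | 0, f => MemLp f 2 volume
  | m + 1, f => WeightedSobolev m f ∧ WeightedSobolev m (fun x => (x : ℂ) * f x) ∧
      ∃ f', HasWeakDeriv f f' ∧ WeightedSobolev m f'

theorem WeightedSobolev.congr {m : ℕ} {f g : ℝ → ℂ} (hf : WeightedSobolev m f)
    (h : f =ᵐ[volume] g) : WeightedSobolev m g := by
  induction m generalizing f g with
  | zero => exact MemLp.ae_eq h hf
  | succ m ih =>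
    obtain ⟨h0, h1, f', hf', h2⟩ := hf
    refine ⟨ih h0 h, ih h1 ?_, f', hf'.congr h EventuallyEq.rfl, h2⟩
    filter_upwards [h] with x hx
    rw [hx]

theorem WeightedSobolev.add {m : ℕ} {f g : ℝ → ℂ} (hf : WeightedSobolev m f)
    (hg : WeightedSobolev m g) : WeightedSobolev m fun x => f x + g x := by
  induction m generalizing f g with
  | zero => exact MemLp.add hf hg
  | succ m ih =>
    obtain ⟨h0, h1, f', hf', h2⟩ := hf
    obtain ⟨k0, k1, g', hg', k2⟩ := hg
    exact ⟨ih h0 k0, by simpa only [mul_add] using ih h1 k1, _, hf'.add hg', ih h2 k2⟩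

theorem WeightedSobolev.const_mul {m : ℕ} {f : ℝ → ℂ} (hf : WeightedSobolev m f) (c : ℂ) :
    WeightedSobolev m fun x => c * f x := by
  induction m generalizing f with
  | zero => exact MemLp.const_mul hf c
  | succ m ih =>
    obtain ⟨h0, h1, f', hf', h2⟩ := hf
    exact ⟨ih h0, by simpa only [mul_left_comm] using ih h1, _, hf'.const_mul c, ih h2⟩

theorem WeightedSobolev.of_succ {m : ℕ} {f : ℝ → ℂ} (hf : WeightedSobolev (m + 1) f) :
    WeightedSobolev m f :=
  hf.1

theorem WeightedSobolev.id_mul {m : ℕ} {f : ℝ → ℂ} (hf : WeightedSobolev (m + 1) f) :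
    WeightedSobolev m fun x => (x : ℂ) * f x :=
  hf.2.1

theorem WeightedSobolev.weakDeriv {m : ℕ} {f f' : ℝ → ℂ} (hf : WeightedSobolev (m + 1) f)
    (h : HasWeakDeriv f f') : WeightedSobolev m f' := by
  obtain ⟨_, _, g, hg, h2⟩ := hf
  exact h2.congr (hg.unique h)

theorem WeightedSobolev.memLp {m : ℕ} {f : ℝ → ℂ} (hf : WeightedSobolev m f) :
    MemLp f 2 volume := by
  induction m with
  | zero => exact hf
  | succ m ih => exact ih hf.of_succ

/-! ### Energy estimates for the harmonic oscillator -/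

/-- The way in which integration by parts enters the estimates: the integral of `F'` vanishes, so a
nonnegative function bounded by `Re F' + G` is integrable, with integral at most that of `G`. -/
theorem HasWeakDeriv.integral_le_of_le_re {F F' : ℝ → ℂ} (h : HasWeakDeriv F F')
    (hF : Integrable F) (hF' : Integrable F') {Φ G : ℝ → ℝ} (hΦ : AEStronglyMeasurable Φ volume)
    (hG : Integrable G) (h0 : ∀ x, 0 ≤ Φ x) (hle : ∀ x, Φ x ≤ (F' x).re + G x) :
    Integrable Φ ∧ ∫ x, Φ x ≤ ∫ x, G x := by
  have hre : Integrable fun x => (F' x).re := hF'.re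
  have hi : Integrable fun x => (F' x).re + G x := hre.add hG
  have hΦi : Integrable Φ := hi.mono' hΦ (Eventually.of_forall fun x => by
    rw [Real.norm_eq_abs, abs_of_nonneg (h0 x)]
    exact hle x)
  refine ⟨hΦi, (integral_mono hΦi hi hle).trans ?_⟩
  rw [integral_add hre hG]
  have : ∫ x, (F' x).re = (∫ x, F' x).re := integral_re hF'
  rw [this, h.integral_eq_zero hF hF']
  simp

/-- Fatou's lemma for a sequence of nonnegative functions with bounded integrals. -/
theorem integrable_of_tendsto_of_integral_le {Φ : ℕ → ℝ → ℝ} {Ψ : ℝ → ℝ} {C : ℝ}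
    (h0 : ∀ n x, 0 ≤ Φ n x) (hi : ∀ n, Integrable (Φ n)) (hC : ∀ n, ∫ x, Φ n x ≤ C)
    (h : ∀ x, Tendsto (fun n => Φ n x) atTop (𝓝 (Ψ x))) : Integrable Ψ := by
  refine integrable_of_tendsto (Eventually.of_forall h) (fun n => (hi n).1) ?_
  have : ∀ n, ∫⁻ x, ‖Φ n x‖ₑ ≤ ENNReal.ofReal C := fun n => by
    rw [← ofReal_integral_norm_eq_lintegral_enorm (hi n)]
    refine ENNReal.ofReal_le_ofReal ((hC n).trans' (le_of_eq ?_))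
    exact integral_congr_ae (Eventually.of_forall fun x => abs_of_nonneg (h0 n x))
  refine ne_top_of_le_ne_top (ENNReal.ofReal_ne_top (r := C))
    (liminf_le_of_le (by isBoundedDefault) fun b hb => ?_)
  obtain ⟨n, hn⟩ := hb.exists
  exact hn.trans (this n)

theorem hasDerivAt_sq_max_zero (s : ℝ) :
    HasDerivAt (fun t : ℝ => max 0 t ^ 2) (2 * max 0 s) s := by
  rcases lt_trichotomy s 0 with h | rfl | h
  · rw [max_eq_left h.le, mul_zero]
    refine (hasDerivAt_const s (0 : ℝ)).congr_of_eventuallyEq ?_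
    filter_upwards [gt_mem_nhds h] with t ht
    simp [max_eq_left ht.le]
  · rw [hasDerivAt_iff_isLittleO]
    have h2 : (fun t : ℝ => t ^ 2) =o[𝓝 0] fun t : ℝ => t := by
      simpa using Asymptotics.isLittleO_pow_id (𝕜 := ℝ) (n := 2) (by norm_num)
    refine Asymptotics.IsBigO.trans_isLittleO (g := fun t : ℝ => t ^ 2) ?_ (by simpa using h2)
    refine Asymptotics.IsBigO.of_bound 1 (Eventually.of_forall fun t => ?_)
    rcases le_total 0 t with ht | ht <;> simp [ht, sq_nonneg]
  · rw [max_eq_right h.le]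
    refine (by simpa using hasDerivAt_pow 2 s : HasDerivAt (fun t : ℝ => t ^ 2) (2 * s) s)
      |>.congr_of_eventuallyEq ?_
    filter_upwards [lt_mem_nhds h] with t ht
    simp [max_eq_right ht.le]

/-- Compactly supported `C¹` cutoffs tending to `1`, with derivatives controlled both by the
square root of the cutoff and by `1 / |x|`. -/
theorem exists_cutoff : ∃ q q' : ℕ → ℝ → ℝ, (∀ n x, HasDerivAt (q n) (q' n x) x) ∧
    (∀ n, Continuous (q' n)) ∧ (∀ n, HasCompactSupport (q n)) ∧ (∀ n x, 0 ≤ q n x) ∧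
    (∀ n x, q n x ≤ 1) ∧ (∀ n x, q' n x ^ 2 ≤ 16 * q n x) ∧ (∀ n x, |x * q' n x| ≤ 4) ∧
    ∀ x, Tendsto (fun n => q n x) atTop (𝓝 1) := by
  have hδ : ∀ n : ℕ, 0 < 1 / ((n : ℝ) + 1) ∧ 1 / ((n : ℝ) + 1) ≤ 1 := fun n =>
    ⟨by positivity, by rw [div_le_one (by positivity)]; linarith [n.cast_nonneg (α := ℝ)]⟩
  set δ : ℕ → ℝ := fun n => 1 / ((n : ℝ) + 1)
  have hp1 : ∀ n x, max 0 (1 - δ n * x ^ 2) ≤ 1 := fun n x => by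
    have := (hδ n).1
    exact max_le zero_le_one (by nlinarith [sq_nonneg x])
  -- where the cutoff does not vanish, `δ x² ≤ 1`
  have hpx : ∀ n x, δ n * x ^ 2 * max 0 (1 - δ n * x ^ 2) ≤ max 0 (1 - δ n * x ^ 2) := by
    intro n x
    rcases le_total (1 - δ n * x ^ 2) 0 with h | h
    · simp [h]
    · rw [max_eq_right h]
      have := (hδ n).1
      nlinarith [sq_nonneg x]
  refine ⟨fun n x => max 0 (1 - δ n * x ^ 2) ^ 2,
    fun n x => 2 * max 0 (1 - δ n * x ^ 2) * (-(δ n * (2 * x))), ?_, ?_, ?_, ?_, ?_, ?_, ?_, ?_⟩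
  · intro n x
    have h1 : HasDerivAt (fun x : ℝ => 1 - δ n * x ^ 2) (-(δ n * (2 * x))) x := by
      simpa using ((hasDerivAt_pow 2 x).const_mul (δ n)).const_sub 1
    exact (hasDerivAt_sq_max_zero _).comp x h1
  · intro n
    fun_prop
  · intro n
    refine HasCompactSupport.of_support_subset_isCompact
      (isCompact_Icc (a := -((n : ℝ) + 1)) (b := (n : ℝ) + 1)) fun x hx => ?_
    have h1 : 0 < 1 - δ n * x ^ 2 := by
      by_contra h
      exact hx (by simp [max_eq_left (not_lt.1 h)])
    have h2 : x ^ 2 < (n : ℝ) + 1 := by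
      have h3 : δ n * ((n : ℝ) + 1) = 1 := by simp only [δ]; field_simp
      have := (hδ n).1
      nlinarith
    exact abs_le.1 (abs_le_of_sq_le_sq (by nlinarith [n.cast_nonneg (α := ℝ)]) (by positivity))
  · intro n x
    positivity
  · intro n x
    exact pow_le_one₀ (le_max_left _ _) (hp1 n x)
  · intro n x
    have h1 := hpx n x
    have h2 := hδ n
    set p := max 0 (1 - δ n * x ^ 2) with hp
    have hp0 : 0 ≤ p := le_max_left _ _
    have h3 : δ n * (δ n * x ^ 2 * p) ≤ 1 * p := by
      have : 0 ≤ δ n * x ^ 2 * p := by have := h2.1; positivity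
      nlinarith
    nlinarith
  · intro n x
    have h1 := hpx n x
    have h2 := hp1 n x
    have h3 := (hδ n).1
    set p := max 0 (1 - δ n * x ^ 2) with hp
    have hp0 : 0 ≤ p := le_max_left _ _
    have : 0 ≤ δ n * x ^ 2 * p := by positivity
    rw [abs_le]
    constructor <;> nlinarith
  · intro x
    have h1 : Tendsto (fun n => max 0 (1 - δ n * x ^ 2) ^ 2) atTop
        (𝓝 (max 0 (1 - 0 * x ^ 2) ^ 2)) :=
      (tendsto_const_nhds.max
        ((tendsto_one_div_add_atTop_nhds_zero_nat.mul_const _).const_sub 1)).pow 2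
    simpa using h1

/-- The energy identity `∫ (w u' ū)' = 0` for the oscillator, with a compactly supported weight
`w`, in the form of an integrated inequality. -/
theorem energy_le {u v f₂ g : ℝ → ℂ} (hu : Continuous u) (hv : Continuous v)
    (h₁ : HasWeakDeriv u v) (h₂ : HasWeakDeriv v f₂) (hg : MemLp g 2 volume)
    (hgf : ∀ x, f₂ x = (x : ℂ) ^ 2 * u x - g x) {w w' : ℝ → ℝ}
    (hw : ∀ x, HasDerivAt w (w' x) x) (hw' : Continuous w') (hws : HasCompactSupport w)
    {Φ G : ℝ → ℝ} (hΦ : AEStronglyMeasurable Φ volume)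
    (hG : Integrable G) (h0 : ∀ x, 0 ≤ Φ x)
    (hle : ∀ x, Φ x ≤ w' x * (v x * conj (u x)).re + w x * (f₂ x * conj (u x)).re +
      w x * ‖v x‖ ^ 2 + G x) :
    Integrable Φ ∧ ∫ x, Φ x ≤ ∫ x, G x := by
  have hwc : Continuous w := continuous_iff_continuousAt.2 fun x => (hw x).continuousAt
  have hws' : HasCompactSupport w' := by
    have : w' = deriv w := funext fun x => (hw x).deriv.symm
    rw [this]
    exact hws.deriv
  have hW : HasWeakDeriv (fun x => (w x : ℂ)) fun x => (w' x : ℂ) :=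
    .of_hasDerivAt (fun x => (hw x).ofReal_comp) (by fun_prop)
  have hs : ∀ {a : ℝ → ℝ} {b : ℝ → ℂ}, Continuous a → HasCompactSupport a → Continuous b →
      Integrable fun x => (a x : ℂ) * b x := by
    intro a b ha hac hb
    refine Continuous.integrable_of_hasCompactSupport (by fun_prop) ?_
    exact (hac.comp_left Complex.ofReal_zero).mul_right
  have hwu : MemLp (fun x => (w x : ℂ) * conj (u x)) 2 volume :=
    Continuous.memLp_of_hasCompactSupport (by fun_prop)
      (hws.comp_left Complex.ofReal_zero).mul_right
  have huc : Continuous fun x => conj (u x) := by fun_prop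
  have h3 : Integrable fun x => (w x : ℂ) * (f₂ x * conj (u x)) := by
    refine ((hs hwc hws (b := fun x => (x : ℂ) ^ 2 * u x * conj (u x)) (by fun_prop)).sub
      (hg.integrable_mul hwu)).congr (Eventually.of_forall fun x => ?_)
    simp only [Pi.sub_apply, Pi.mul_apply, hgf x]
    ring
  refine (hW.mul (h₂.mul h₁.conj)).integral_le_of_le_re
    (hs hwc hws (by fun_prop))
    ((hs hw' hws' (by fun_prop)).add ((h3.add (hs hwc hws (b := fun x => v x * conj (v x))
      (by fun_prop))).congr (Eventually.of_forall fun x => by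
        simp only [Pi.add_apply]
        ring)))
    hΦ hG h0 fun x => (hle x).trans (le_of_eq ?_)
  simp only [mul_add, Complex.add_re, Complex.re_ofReal_mul, Complex.mul_conj, Complex.ofReal_re,
    Complex.normSq_eq_norm_sq]
  ring

theorem abs_re_mul_conj_le (a b : ℂ) : |(a * conj b).re| ≤ ‖a‖ * ‖b‖ := by
  simpa using Complex.abs_re_le_norm (a * conj b)

theorem memLp_two_of_integrable_sq {f : ℝ → ℂ} (hf : AEStronglyMeasurable f volume)
    (h : Integrable fun x => ‖f x‖ ^ 2) : MemLp f 2 volume :=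
  (memLp_two_iff_integrable_sq_norm hf).2 h

theorem memLp_two_of_integrable_sum {f : ℝ → ℂ} {Ψ : ℝ → ℝ} (hf : AEStronglyMeasurable f volume)
    (hΨ : Integrable Ψ) (h : ∀ x, ‖f x‖ ^ 2 ≤ Ψ x) : MemLp f 2 volume :=
  memLp_two_of_integrable_sq hf <| hΨ.mono' (hf.norm.pow 2) (Eventually.of_forall fun x => by
    rw [Real.norm_eq_abs, abs_of_nonneg (by positivity)]
    exact h x)

theorem _root_.MeasureTheory.MemLp.integrable_sq_norm {f : ℝ → ℂ} (h : MemLp f 2 volume) :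
    Integrable fun x => ‖f x‖ ^ 2 :=
  (memLp_two_iff_integrable_sq_norm h.1).1 h

/-- If `f` and `-f'' + x² f` are in `L²`, then so are `f'` and `x f`: test with `χ f` for cutoffs
`χ` tending to `1`. -/
theorem memLp_of_oscillator {u v f₂ g : ℝ → ℂ} (hu : Continuous u) (hv : Continuous v)
    (h₁ : HasWeakDeriv u v) (h₂ : HasWeakDeriv v f₂) (hul : MemLp u 2 volume)
    (hg : MemLp g 2 volume) (hgf : ∀ x, f₂ x = (x : ℂ) ^ 2 * u x - g x) :
    MemLp v 2 volume ∧ MemLp (fun x : ℝ => (x : ℂ) * u x) 2 volume := by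
  obtain ⟨q, q', hq, hqc, hqs, hq0, hq1, hqq, -, hqt⟩ := exists_cutoff
  have hcont : ∀ n, Continuous (q n) := fun n =>
    continuous_iff_continuousAt.2 fun x => (hq n x).continuousAt
  have key : ∀ n, _ := fun n => energy_le hu hv h₁ h₂ hg hgf (hq n) (hqc n) (hqs n)
    (Φ := fun x => q n x * (‖v x‖ ^ 2 / 2 + ‖(x : ℂ) * u x‖ ^ 2))
    (G := fun x => 9 * ‖u x‖ ^ 2 + ‖g x‖ ^ 2)
    (by have := hcont n; exact Continuous.aestronglyMeasurable (by fun_prop))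
    ((hul.integrable_sq_norm.const_mul 9).add hg.integrable_sq_norm)
    (fun x => mul_nonneg (hq0 n x) (by positivity)) (by
      intro x
      have e1 : (f₂ x * conj (u x)).re = ‖(x : ℂ) * u x‖ ^ 2 - (g x * conj (u x)).re := by
        rw [hgf, Complex.sq_norm]
        simp [Complex.normSq_apply, pow_two]
        ring
      have e2 := abs_re_mul_conj_le (v x) (u x)
      have e3 := abs_re_mul_conj_le (g x) (u x)
      rw [e1]
      have a1 : -(q' n x * (v x * conj (u x)).re) ≤ q n x * ‖v x‖ ^ 2 / 2 + 8 * ‖u x‖ ^ 2 := by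
        have b1 : -(q' n x * (v x * conj (u x)).re) ≤ |q' n x| * ‖v x‖ * ‖u x‖ := by
          refine (neg_le_abs _).trans ?_
          rw [abs_mul, mul_assoc]
          gcongr
        have b2 : (|q' n x| * ‖v x‖) ^ 2 ≤ 16 * q n x * ‖v x‖ ^ 2 := by
          rw [mul_pow, sq_abs]
          gcongr
          exact hqq n x
        nlinarith [sq_nonneg (|q' n x| * ‖v x‖ - 16 * ‖u x‖)]
      have a2 : q n x * (g x * conj (u x)).re ≤ ‖g x‖ ^ 2 + ‖u x‖ ^ 2 := by
        have b1 : (g x * conj (u x)).re ≤ ‖g x‖ * ‖u x‖ := (le_abs_self _).trans e3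
        have b2 := hq0 n x
        have b3 := hq1 n x
        have b4 : q n x * (g x * conj (u x)).re ≤ q n x * (‖g x‖ * ‖u x‖) := by gcongr
        have b5 : q n x * (‖g x‖ * ‖u x‖) ≤ 1 * (‖g x‖ * ‖u x‖) := by gcongr
        nlinarith [sq_nonneg (‖g x‖ - ‖u x‖), sq_nonneg (‖g x‖), sq_nonneg (‖u x‖)]
      linarith)
  have hΨ := integrable_of_tendsto_of_integral_le
    (fun n x => mul_nonneg (hq0 n x) (by positivity)) (fun n => (key n).1) (fun n => (key n).2)
    (fun x => (hqt x).mul_const _)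
  simp only [one_mul] at hΨ
  refine ⟨memLp_two_of_integrable_sum hv.aestronglyMeasurable (hΨ.const_mul 2) fun x => ?_,
    memLp_two_of_integrable_sum (by fun_prop) hΨ fun x => ?_⟩
  · nlinarith [sq_nonneg ‖(x : ℂ) * u x‖]
  · nlinarith [sq_nonneg ‖v x‖]

/-- The pointwise inequality behind the second order energy estimate, with weight `x² q`. It rests
on expanding `|g|² = |x² u - u''|²`. -/
theorem weighted_energy_density_le {x q q' : ℝ} {u v f₂ g : ℂ} (b2 : 0 ≤ q) (b3 : q ≤ 1)
    (hx : |x * q'| ≤ 4) (hgf : f₂ = (x : ℂ) ^ 2 * u - g) :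
    q * (‖f₂‖ ^ 2 / 2 + ‖(x : ℂ) * v‖ ^ 2 + ‖(x : ℂ) ^ 2 * u‖ ^ 2 / 2) ≤
      (2 * x * q + x ^ 2 * q') * (v * conj u).re + x ^ 2 * q * (f₂ * conj u).re +
        x ^ 2 * q * ‖v‖ ^ 2 + (3 * (‖v‖ ^ 2 + ‖(x : ℂ) * u‖ ^ 2) + ‖g‖ ^ 2) := by
  have e1 : ‖f₂‖ ^ 2 / 2 + ‖(x : ℂ) ^ 2 * u‖ ^ 2 / 2 =
      ‖g‖ ^ 2 / 2 + x ^ 2 * (f₂ * conj (u)).re := by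
    have : g = (x : ℂ) ^ 2 * u - f₂ := by rw [hgf]; ring
    rw [this]
    simp only [Complex.sq_norm]
    simp [Complex.normSq_apply, pow_two]
    ring
  have e2 := abs_re_mul_conj_le (v) (u)
  have e3 : ‖(x : ℂ) * v‖ ^ 2 = x ^ 2 * ‖v‖ ^ 2 := by
    rw [norm_mul, mul_pow, Complex.norm_real, Real.norm_eq_abs, sq_abs]
  have e4 : ‖(x : ℂ) * u‖ = |x| * ‖u‖ := by
    rw [norm_mul, Complex.norm_real, Real.norm_eq_abs]
  have a1 : -((2 * x * q + x ^ 2 * q') * (v * conj (u)).re) ≤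
      3 * (‖v‖ ^ 2 + ‖(x : ℂ) * u‖ ^ 2) := by
    have c1 : |2 * x * q + x ^ 2 * q'| ≤ 6 * |x| := by
      have : 2 * x * q + x ^ 2 * q' = x * (2 * q + x * q') := by ring
      rw [this, abs_mul, mul_comm]
      gcongr
      have := abs_le.1 (hx)
      rw [abs_le]
      constructor <;> linarith
    have c2 : -((2 * x * q + x ^ 2 * q') * (v * conj (u)).re) ≤
        6 * |x| * (‖v‖ * ‖u‖) := by
      refine (neg_le_abs _).trans ?_
      rw [abs_mul]
      gcongr
    rw [e4]
    nlinarith [sq_nonneg (‖v‖ - |x| * ‖u‖)]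
  have a2 : q * (‖g‖ ^ 2 / 2) ≤ ‖g‖ ^ 2 := by
    nlinarith [sq_nonneg ‖g‖]
  rw [e3]
  linear_combination a1 + a2 + q * e1

/-- Second order estimate: if moreover `f'` and `x f` are in `L²`, then so are `f''`, `x f'` and
`x² f`: test with `χ x² f` for cutoffs `χ` tending to `1`. -/
theorem memLp_of_oscillator_two {u v f₂ g : ℝ → ℂ} (hu : Continuous u) (hv : Continuous v)
    (h₁ : HasWeakDeriv u v) (h₂ : HasWeakDeriv v f₂) (hvl : MemLp v 2 volume)
    (hxu : MemLp (fun x : ℝ => (x : ℂ) * u x) 2 volume)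
    (hg : MemLp g 2 volume) (hgf : ∀ x, f₂ x = (x : ℂ) ^ 2 * u x - g x) :
    MemLp f₂ 2 volume ∧ MemLp (fun x : ℝ => (x : ℂ) * v x) 2 volume ∧
      MemLp (fun x : ℝ => (x : ℂ) ^ 2 * u x) 2 volume := by
  obtain ⟨q, q', hq, hqc, hqs, hq0, hq1, -, hqx, hqt⟩ := exists_cutoff
  have hcont : ∀ n, Continuous (q n) := fun n =>
    continuous_iff_continuousAt.2 fun x => (hq n x).continuousAt
  have hf2 := h₂.aestronglyMeasurable_deriv
  have hw : ∀ n x, HasDerivAt (fun x => x ^ 2 * q n x) (2 * x * q n x + x ^ 2 * q' n x) x := by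
    intro n x
    have h := (hasDerivAt_pow 2 x).mul (hq n x)
    norm_num at h
    exact h
  have hwc : ∀ n, Continuous fun x => 2 * x * q n x + x ^ 2 * q' n x := by
    intro n
    have := hcont n
    have := hqc n
    fun_prop
  have hws : ∀ n, HasCompactSupport fun x => x ^ 2 * q n x := fun n => (hqs n).mul_left
  have key : ∀ n, Integrable (fun x => q n x *
      (‖f₂ x‖ ^ 2 / 2 + ‖(x : ℂ) * v x‖ ^ 2 + ‖(x : ℂ) ^ 2 * u x‖ ^ 2 / 2)) ∧
      ∫ x, q n x * (‖f₂ x‖ ^ 2 / 2 + ‖(x : ℂ) * v x‖ ^ 2 + ‖(x : ℂ) ^ 2 * u x‖ ^ 2 / 2) ≤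
        ∫ x, (3 * (‖v x‖ ^ 2 + ‖(x : ℂ) * u x‖ ^ 2) + ‖g x‖ ^ 2) := fun n =>
    energy_le hu hv h₁ h₂ hg hgf
    (hw n) (hwc n) (hws n)
    (by have := hcont n; fun_prop)
    (((hvl.integrable_sq_norm.add hxu.integrable_sq_norm).const_mul 3).add hg.integrable_sq_norm)
    (fun x => mul_nonneg (hq0 n x) (by positivity)) fun x =>
      weighted_energy_density_le (hq0 n x) (hq1 n x) (hqx n x) (hgf x)
  have hΨ := integrable_of_tendsto_of_integral_le
    (fun n x => mul_nonneg (hq0 n x) (by positivity)) (fun n => (key n).1) (fun n => (key n).2)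
    (fun x => (hqt x).mul_const _)
  simp only [one_mul] at hΨ
  have s1 := fun x => sq_nonneg ‖f₂ x‖
  have s2 := fun x : ℝ => sq_nonneg ‖(x : ℂ) * v x‖
  have s3 := fun x : ℝ => sq_nonneg ‖(x : ℂ) ^ 2 * u x‖
  refine ⟨memLp_two_of_integrable_sum hf2 (hΨ.const_mul 2) fun x => ?_,
    memLp_two_of_integrable_sum (by fun_prop) hΨ fun x => ?_,
    memLp_two_of_integrable_sum (by fun_prop) (hΨ.const_mul 2) fun x => ?_⟩
  all_goals linarith [s1 x, s2 x, s3 x]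

/-- If `f` and `-f'' + x² f` are in `L²`, then `f` is of order two, so that the separate terms
`f''` and `x² f` are in `L²` as well. -/
theorem weightedSobolev_two {f f₁ f₂ : ℝ → ℂ} (h₁ : HasWeakDeriv f f₁) (h₂ : HasWeakDeriv f₁ f₂)
    (hf : MemLp f 2 volume) (hg : MemLp (fun x => -f₂ x + (x : ℂ) ^ 2 * f x) 2 volume) :
    WeightedSobolev 2 f := by
  obtain ⟨u, hu, hfu⟩ := h₁.ae_eq_continuous
  obtain ⟨v, hv, hfv⟩ := h₂.ae_eq_continuous
  suffices WeightedSobolev 2 u from this.congr hfu.symm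
  replace h₁ := h₁.congr hfu hfv
  replace h₂ := h₂.congr hfv EventuallyEq.rfl
  replace hf := hf.ae_eq hfu
  replace hg : MemLp (fun x => -f₂ x + (x : ℂ) ^ 2 * u x) 2 volume := by
    refine hg.ae_eq ?_
    filter_upwards [hfu] with x hx
    rw [hx]
  have hgf : ∀ x, f₂ x = (x : ℂ) ^ 2 * u x - (-f₂ x + (x : ℂ) ^ 2 * u x) := fun x => by ring
  obtain ⟨hvl, hxu⟩ := memLp_of_oscillator hu hv h₁ h₂ hf hg hgf
  obtain ⟨hf2, hxv, hxxu⟩ := memLp_of_oscillator_two hu hv h₁ h₂ hvl hxu hg hgf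
  refine ⟨⟨hf, hxu, v, h₁, hvl⟩, ⟨hxu, ?_, _, h₁.id_mul, hf.add hxv⟩, v, h₁, hvl, hxv, f₂, h₂, hf2⟩
  simpa only [WeightedSobolev, pow_two, mul_assoc] using hxxu

/-! ### Elliptic regularity -/

/-- Elliptic regularity: if `f ∈ L²` and `-f'' + x² f` is of order `m`, then `f` is of order
`m + 2`. Differentiation and multiplication by `x` commute with the oscillator up to terms of lower
order, so the step from `m` to `m + 1` applies the case `m` to `f'` and to `x f`. -/
theorem WeightedSobolev.of_oscillator {m : ℕ} {f f₁ f₂ : ℝ → ℂ} (h₁ : HasWeakDeriv f f₁)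
    (h₂ : HasWeakDeriv f₁ f₂) (hf : MemLp f 2 volume)
    (hg : WeightedSobolev m fun x => -f₂ x + (x : ℂ) ^ 2 * f x) : WeightedSobolev (m + 2) f := by
  induction m generalizing f f₁ f₂ with
  | zero => exact weightedSobolev_two h₁ h₂ hf hg
  | succ m ih =>
    have hf2 : WeightedSobolev (m + 2) f := ih h₁ h₂ hf hg.of_succ
    obtain ⟨hg0, hgx, g', hg', hgd⟩ := hg
    have hx1 := h₁.id_mul
    have hx2 := hx1.id_mul
    -- `f'' = x² f - g` is itself weakly differentiable.
    have h₃ : HasWeakDeriv f₂ fun x => 2 * ((x : ℂ) * f x) + (x : ℂ) ^ 2 * f₁ x - g' x :=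
      (hx2.add (hg'.const_mul (-1))).congr (Eventually.of_forall fun x => by dsimp only; ring)
        (Eventually.of_forall fun x => by dsimp only; ring)
    refine ⟨hf2, ?_, f₁, h₁, ?_⟩
    · refine ih hx1 (h₁.add h₂.id_mul) hf2.id_mul.memLp ?_
      refine (hgx.add ((hf2.weakDeriv h₁).of_succ.const_mul (-2))).congr
        (Eventually.of_forall fun x => ?_)
      dsimp only
      ring
    · refine ih h₂ h₃ (hf2.weakDeriv h₁).memLp ?_
      refine (hgd.add (hf2.id_mul.of_succ.const_mul (-2))).congr (Eventually.of_forall fun x => ?_)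
      dsimp only
      ring

/-! ### Domains of powers -/

theorem mem_compOp_graph {E : Type*} [AddCommGroup E] [Module ℂ E] (A B : E →ₗ.[ℂ] E) (f h : E) :
    (f, h) ∈ (compOp A B).graph ↔ ∃ g, (f, g) ∈ B.graph ∧ (g, h) ∈ A.graph := by
  simp only [LinearPMap.mem_graph_iff]
  constructor
  · rintro ⟨⟨y, hy⟩, rfl, rfl⟩
    obtain ⟨hB, hA⟩ := (mem_compOp_domain A B y).1 hy
    exact ⟨B ⟨y, hB⟩, ⟨⟨y, hB⟩, rfl, rfl⟩, ⟨_, hA⟩, rfl, (compOp_apply A B y hB hA).symm⟩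
  · rintro ⟨g, ⟨⟨y, hB⟩, rfl, rfl⟩, ⟨z, hA⟩, hz, rfl⟩
    dsimp only at hz
    subst hz
    exact ⟨⟨y, (mem_compOp_domain A B y).2 ⟨hB, hA⟩⟩, rfl, compOp_apply A B y hB hA⟩

theorem mem_powOp_zero_graph {E : Type*} [AddCommGroup E] [Module ℂ E] (A : E →ₗ.[ℂ] E) (f h : E) :
    (f, h) ∈ (powOp A 0).graph ↔ f = h := by
  simp only [LinearPMap.mem_graph_iff]
  constructor
  · rintro ⟨y, rfl, rfl⟩
    rfl
  · rintro rfl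
    exact ⟨⟨f, trivial⟩, rfl, rfl⟩

theorem mem_powOp_succ_graph {E : Type*} [AddCommGroup E] [Module ℂ E] (A : E →ₗ.[ℂ] E) (n : ℕ)
    (f h : E) :
    (f, h) ∈ (powOp A (n + 1)).graph ↔ ∃ g, (f, g) ∈ A.graph ∧ (g, h) ∈ (powOp A n).graph := by
  induction n generalizing h with
  | zero =>
    change _ ∈ (compOp A (powOp A 0)).graph ↔ _
    simp only [mem_compOp_graph, mem_powOp_zero_graph]
    exact ⟨fun ⟨g, h1, h2⟩ => ⟨h, h1 ▸ h2, rfl⟩, fun ⟨g, h1, h2⟩ => ⟨f, rfl, h2 ▸ h1⟩⟩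
  | succ n ih =>
    change _ ∈ (compOp A (powOp A (n + 1))).graph ↔ _
    rw [mem_compOp_graph]
    simp only [ih]
    change _ ↔ ∃ g, (f, g) ∈ A.graph ∧ (g, h) ∈ (compOp A (powOp A n)).graph
    simp only [mem_compOp_graph]
    constructor
    · rintro ⟨u, ⟨g, h1, h2⟩, h3⟩
      exact ⟨g, h1, u, h2, h3⟩
    · rintro ⟨g, h1, u, h2, h3⟩
      exact ⟨u, ⟨g, h1, h2⟩, h3⟩

/-- The factors of a power may be peeled off from the right: `dom A ^ (n + 1)` consists of the
`f ∈ dom A` with `A f ∈ dom A ^ n`. -/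
theorem mem_powOp_succ_domain {E : Type*} [AddCommGroup E] [Module ℂ E] (A : E →ₗ.[ℂ] E) (n : ℕ)
    (f : E) :
    f ∈ (powOp A (n + 1)).domain ↔ ∃ g, (f, g) ∈ A.graph ∧ g ∈ (powOp A n).domain := by
  simp only [LinearPMap.mem_domain_iff, mem_powOp_succ_graph]
  constructor
  · rintro ⟨h, g, h1, h2⟩
    exact ⟨g, h1, h, h2⟩
  · rintro ⟨g, h1, h, h2⟩
    exact ⟨h, g, h1, h2⟩

/-- The graph of the oscillator in terms of weak derivatives. As the weak derivative `f₁` itself has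
a continuous representative, the representative of `f` is differentiable everywhere, and its
classical derivative is locally absolutely continuous. -/
theorem mem_opHO_graph (f g : L2) :
    (f, g) ∈ opHO.graph ↔ ∃ f₁ f₂ : ℝ → ℂ, HasWeakDeriv f f₁ ∧ HasWeakDeriv f₁ f₂ ∧
      g =ᵐ[volume] fun x => -f₂ x + (x : ℂ) ^ 2 * f x := by
  rw [LinearPMap.mem_graph_iff]
  constructor
  · rintro ⟨⟨y, u, hu⟩, rfl, rfl⟩
    refine ⟨deriv u, deriv (deriv u), ⟨u, hu.ac, hu.ae_eq, EventuallyEq.rfl⟩,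
      ⟨deriv u, hu.ac_deriv, EventuallyEq.rfl, EventuallyEq.rfl⟩, ?_⟩
    simp only [opHO_apply hu]
    filter_upwards [hu.memLp.coeFn_toLp, hu.ae_eq] with x hx hx'
    rw [hx, hx', tau]
  · rintro ⟨f₁, f₂, ⟨u, hu, hfu, hu'⟩, ⟨v, hv, hfv, hv'⟩, hg⟩
    have huv : deriv u = v :=
      funext fun x => (hu.hasDerivAt_of_ae (hu'.trans hfv) hv.continuous x).deriv
    have hτ : tau u =ᵐ[volume] g := by
      filter_upwards [hv', hfu, hg] with x h1 h2 h3
      rw [h3, tau, huv, h1, h2]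
    have hu : IsDomRep f u := ⟨hfu, hu, huv ▸ hv, (Lp.memLp g).ae_eq hτ.symm⟩
    refine ⟨⟨f, u, hu⟩, rfl, ?_⟩
    rw [opHO_apply hu]
    exact Lp.ext (hu.memLp.coeFn_toLp.trans hτ)

/-- The domain of the `k`-th power of the oscillator consists of the functions of weighted Sobolev
order `2 k`. -/
theorem mem_powOp_opHO_domain (k : ℕ) (f : L2) :
    f ∈ (powOp opHO k).domain ↔ WeightedSobolev (2 * k) f := by
  induction k generalizing f with
  | zero => exact ⟨fun _ => Lp.memLp f, fun _ => trivial⟩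
  | succ k ih =>
    rw [mem_powOp_succ_domain]
    simp only [ih, mem_opHO_graph]
    constructor
    · rintro ⟨g, ⟨f₁, f₂, h₁, h₂, hg⟩, hgk⟩
      exact .of_oscillator h₁ h₂ (Lp.memLp f) (hgk.congr hg)
    · intro hf
      obtain ⟨-, hx, f₁, h₁, hd⟩ := id hf
      obtain ⟨-, -, f₂, h₂, hd2⟩ := hd
      have hg : WeightedSobolev (2 * k) fun x => -f₂ x + (x : ℂ) ^ 2 * f x := by
        refine ((hd2.const_mul (-1)).add hx.id_mul).congr (Eventually.of_forall fun x => ?_)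
        dsimp only
        ring
      have he := hg.memLp.coeFn_toLp
      exact ⟨hg.memLp.toLp, ⟨f₁, f₂, h₁, h₂, he⟩, hg.congr he.symm⟩

theorem mem_opX_graph (f g : L2) :
    (f, g) ∈ opX.graph ↔ g =ᵐ[volume] fun x => (x : ℂ) * f x := by
  rw [LinearPMap.mem_graph_iff]
  constructor
  · rintro ⟨⟨y, hy⟩, rfl, rfl⟩
    exact MemLp.coeFn_toLp hy
  · intro h
    have hf : MemLp (fun x : ℝ => (x : ℂ) * f x) 2 volume := (Lp.memLp g).ae_eq h
    exact ⟨⟨f, hf⟩, rfl, Lp.ext (hf.coeFn_toLp.trans h.symm)⟩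

theorem memLp_pow_mul_of_le {n m : ℕ} (hmn : m ≤ n) {f : ℝ → ℂ} (hf : MemLp f 2 volume)
    (h : MemLp (fun x : ℝ => (x : ℂ) ^ n * f x) 2 volume) :
    MemLp (fun x : ℝ => (x : ℂ) ^ m * f x) 2 volume := by
  refine (hf.norm.add h.norm).mono ?_ (Eventually.of_forall fun x => ?_)
  · exact (Complex.continuous_ofReal.pow m).aestronglyMeasurable.mul hf.1
  · have h1 : |x| ^ m ≤ 1 + |x| ^ n := by
      rcases le_total |x| 1 with h | h
      · have := pow_nonneg (abs_nonneg x) n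
        linarith [pow_le_one₀ (n := m) (abs_nonneg x) h]
      · linarith [pow_le_pow_right₀ h hmn]
    simp only [Pi.add_apply, norm_mul, norm_pow, Complex.norm_real, Real.norm_eq_abs]
    refine le_trans ?_ (le_abs_self _)
    nlinarith [norm_nonneg (f x)]

theorem mem_powOp_opX_domain (n : ℕ) (f : L2) :
    f ∈ (powOp opX n).domain ↔ MemLp (fun x : ℝ => (x : ℂ) ^ n * f x) 2 volume := by
  induction n generalizing f with
  | zero => exact ⟨fun _ => by simpa using Lp.memLp f, fun _ => trivial⟩
  | succ n ih =>
    rw [mem_powOp_succ_domain]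
    simp only [ih, mem_opX_graph]
    have key : ∀ g : L2, (g =ᵐ[volume] fun x => (x : ℂ) * f x) →
        (fun x : ℝ => (x : ℂ) ^ n * g x) =ᵐ[volume] fun x => (x : ℂ) ^ (n + 1) * f x := by
      intro g hg
      filter_upwards [hg] with x hx
      rw [hx]
      ring
    constructor
    · rintro ⟨g, hg, hgn⟩
      exact hgn.ae_eq (key g hg)
    · intro h
      have hx : MemLp (fun x : ℝ => (x : ℂ) * f x) 2 volume := by
        simpa using memLp_pow_mul_of_le (m := 1) (by omega) (Lp.memLp f) h
      exact ⟨hx.toLp, hx.coeFn_toLp, h.ae_eq (key _ hx.coeFn_toLp).symm⟩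

/-! ### Sobolev spaces of integer order -/

section Sobolev

open scoped LineDeriv SchwartzMap ContDiff
open TemperedDistribution

/-- Lemma of du Bois-Reymond: a locally integrable function which annihilates the derivatives of
all test functions is constant almost everywhere. -/
theorem ae_eq_const_of_integral_deriv_smul_eq_zero {u : ℝ → ℂ} (hu : LocallyIntegrable u)
    (h : ∀ φ : ℝ → ℝ, ContDiff ℝ ∞ φ → HasCompactSupport φ → ∫ x, deriv φ x • u x = 0) :
    ∃ c : ℂ, u =ᵐ[volume] fun _ => c := by
  let η : ContDiffBump (0 : ℝ) := default
  set e : ℝ → ℝ := η.normed volume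
  have he : ContDiff ℝ ∞ e := η.contDiff_normed
  have hes : HasCompactSupport e := η.hasCompactSupport_normed
  have he1 : ∫ x, e x = 1 := η.integral_normed
  refine ⟨∫ x, e x • u x, ?_⟩
  refine ae_eq_of_integral_contDiff_smul_eq hu (locallyIntegrable_const _) fun ψ hψ hψs => ?_
  -- `ψ - (∫ ψ) e` has integral zero, so it is the derivative of a test function.
  set m := ∫ x, ψ x
  set θ : ℝ → ℝ := fun x => ψ x - m * e x
  have hψi : Integrable ψ := hψ.continuous.integrable_of_hasCompactSupport hψs
  have hei : Integrable e := he.continuous.integrable_of_hasCompactSupport hes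
  have hθ : ContDiff ℝ ∞ θ := hψ.sub (contDiff_const.mul he)
  have hθs : HasCompactSupport θ := hψs.sub hes.mul_left
  have hθ0 : ∫ x, θ x = 0 := by
    rw [integral_sub hψi (hei.const_mul m), integral_const_mul, he1]
    simp [m]
  obtain ⟨R, hR⟩ : ∃ R : ℝ, Function.support θ ⊆ Ioc (-R) R := by
    obtain ⟨R, hR⟩ := hθs.isCompact.isBounded.subset_ball 0
    refine ⟨R, (subset_tsupport θ).trans (hR.trans ?_)⟩
    rw [Real.ball_eq_Ioo]
    simpa using Ioo_subset_Ioc_self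
  set φ : ℝ → ℝ := fun x => ∫ t in (-R)..x, θ t
  have hφ' : ∀ x, HasDerivAt φ (θ x) x := fun x =>
    intervalIntegral.integral_hasDerivAt_right (hθ.continuous.intervalIntegrable _ _)
      (hθ.continuous.stronglyMeasurableAtFilter _ _) hθ.continuous.continuousAt
  have hdφ : deriv φ = θ := funext fun x => (hφ' x).deriv
  have hφ : ContDiff ℝ ∞ φ :=
    contDiff_infty_iff_deriv.2 ⟨fun x => (hφ' x).differentiableAt, hdφ ▸ hθ⟩
  have hφs : HasCompactSupport φ := by
    refine HasCompactSupport.of_support_subset_isCompact (isCompact_Icc (a := -R) (b := R))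
      fun x hx => ?_
    by_contra hxR
    refine hx ?_
    rcases lt_or_ge x (-R) with h1 | h1
    · refine intervalIntegral.integral_zero_ae (Eventually.of_forall fun t ht => ?_)
      by_contra h2
      rw [uIoc_of_ge h1.le] at ht
      exact absurd (hR h2).1 (not_lt.2 ht.2)
    · have h2 : R ≤ x := by
        by_contra h3
        exact hxR ⟨h1, (not_le.1 h3).le⟩
      simp only [φ]
      rw [intervalIntegral.integral_eq_integral_of_support_subset
        (hR.trans (Ioc_subset_Ioc_right h2)), hθ0]
  have hz := h φ hφ hφs
  rw [hdφ] at hz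
  have hint : ∀ {a : ℝ → ℝ}, ContDiff ℝ ∞ a → HasCompactSupport a →
      Integrable fun x => a x • u x := fun ha has =>
    hu.integrable_smul_left_of_hasCompactSupport ha.continuous has
  have : ∫ x, θ x • u x = ∫ x, ψ x • u x - m • (e x • u x) := by
    simp only [θ, sub_smul, mul_smul]
  have hm : Integrable fun x => m • (e x • u x) := (hint he hes).smul m
  rw [this, integral_sub (hint hψ hψs) hm, integral_smul, sub_eq_zero] at hz
  rw [hz, integral_smul_const]

/-- For `L²` functions, the derivative in the sense of tempered distributions is the weak
derivative. -/
theorem lineDerivOp_eq_iff_hasWeakDeriv (f g : L2) :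
    ∂_{(1 : ℝ)} (f : 𝓢'(ℝ, ℂ)) = (g : 𝓢'(ℝ, ℂ)) ↔ HasWeakDeriv f g := by
  have hderiv : ∀ (φ : 𝓢(ℝ, ℂ)) (x : ℝ), (∂_{(1 : ℝ)} φ) x = deriv φ x := fun φ x => by
    rw [SchwartzMap.lineDerivOp_apply, φ.differentiableAt.lineDeriv_eq_fderiv,
      fderiv_apply_one_eq_deriv]
  have hiff : ∂_{(1 : ℝ)} (f : 𝓢'(ℝ, ℂ)) = (g : 𝓢'(ℝ, ℂ)) ↔
      ∀ φ : 𝓢(ℝ, ℂ), ∫ x, deriv φ x * f x = -∫ x, φ x * g x := by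
    constructor
    · intro h φ
      have := DFunLike.congr_fun h φ
      rw [lineDerivOp_apply_apply, Lp.toTemperedDistribution_apply,
        Lp.toTemperedDistribution_apply] at this
      simp only [smul_eq_mul, neg_apply, hderiv, neg_mul, integral_neg] at this
      rw [← this, neg_neg]
    · intro h
      ext φ
      rw [lineDerivOp_apply_apply, Lp.toTemperedDistribution_apply,
        Lp.toTemperedDistribution_apply]
      simp only [smul_eq_mul, neg_apply, hderiv, neg_mul, integral_neg]
      rw [h, neg_neg]
  rw [hiff]
  constructor
  · intro h
    have hgl : LocallyIntegrable g := (Lp.memLp g).locallyIntegrable (by norm_num)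
    have hfl : LocallyIntegrable f := (Lp.memLp f).locallyIntegrable (by norm_num)
    set G : ℝ → ℂ := fun x => ∫ t in (0 : ℝ)..x, g t
    have hG : LocAC G := LocAC.primitive hgl
    have hG' : deriv G =ᵐ[volume] g :=
      (LocallyIntegrable.ae_hasDerivAt_integral hgl).mono fun x hx => (hx 0).deriv
    obtain ⟨c, hc⟩ := ae_eq_const_of_integral_deriv_smul_eq_zero
      (hfl.sub hG.continuous.locallyIntegrable) fun φ hφ hφs => by
        have hφ' : ContDiff ℝ ∞ (deriv φ) := (contDiff_infty_iff_deriv.1 hφ).2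
        have hφc : ContDiff ℝ ∞ fun x => (φ x : ℂ) := Complex.ofRealCLM.contDiff.comp hφ
        have hφcs : HasCompactSupport fun x => (φ x : ℂ) := hφs.comp_left Complex.ofReal_zero
        have hd : ∀ x, HasDerivAt (fun x => (φ x : ℂ)) ((deriv φ x : ℝ) : ℂ) x := fun x =>
          ((hφ.differentiable (by simp)) x).hasDerivAt.ofReal_comp
        have h1 : ∫ x, ((deriv φ x : ℝ) : ℂ) * f x = -∫ x, (φ x : ℂ) * g x := by
          have := h (hφcs.toSchwartzMap hφc)
          have hco : ⇑(hφcs.toSchwartzMap hφc) = fun x => (φ x : ℂ) := rfl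
          simpa only [hco, fun x => (hd x).deriv] using this
        have i1 : Integrable fun x => (φ x : ℂ) * g x := by
          simpa only [Complex.real_smul] using
            hgl.integrable_smul_left_of_hasCompactSupport hφ.continuous hφs
        have i2 : Integrable fun x => ((deriv φ x : ℝ) : ℂ) * G x := by
          simpa only [Complex.real_smul] using
            hG.continuous.locallyIntegrable.integrable_smul_left_of_hasCompactSupport
              hφ'.continuous hφs.deriv
        have i3 : Integrable fun x => (φ x : ℂ) * G x := by
          simpa only [Complex.real_smul] using
            hG.continuous.locallyIntegrable.integrable_smul_left_of_hasCompactSupport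
              hφ.continuous hφs
        have i4 : Integrable fun x => ((deriv φ x : ℝ) : ℂ) * f x := by
          simpa only [Complex.real_smul] using
            hfl.integrable_smul_left_of_hasCompactSupport hφ'.continuous hφs.deriv
        have hw : HasWeakDeriv (fun x => (φ x : ℂ)) fun x => ((deriv φ x : ℝ) : ℂ) :=
          .of_hasDerivAt hd (Complex.continuous_ofReal.comp hφ'.continuous)
        have h2 := (hw.mul ⟨G, hG, EventuallyEq.rfl, hG'⟩).integral_eq_zero i3 (i2.add i1)
        rw [integral_add i2 i1] at h2
        simp only [Pi.sub_apply, smul_sub, Complex.real_smul]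
        rw [integral_sub i4 i2, h1]
        linear_combination -h2
    refine ⟨fun x => G x + c, fun a b => ?_, ?_, ?_⟩
    · exact (hG a b).add (contDiff_const (c := c)).contDiffOn.absolutelyContinuousOnInterval
    · filter_upwards [hc] with x hx
      rw [← hx]
      simp
    · simpa using hG'
  · intro h φ
    have hw : HasWeakDeriv φ (deriv φ) :=
      .of_hasDerivAt (fun x => φ.differentiableAt.hasDerivAt) (φ.smooth 1).continuous_deriv_one
    have m1 : MemLp (deriv φ) 2 volume := (SchwartzMap.derivCLM ℂ ℂ φ).memLp 2 volume
    have i1 := m1.integrable_mul (Lp.memLp f)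
    have i2 := (φ.memLp 2 (μ := volume)).integrable_mul (Lp.memLp g)
    have h2 := (hw.mul h).integral_eq_zero
      ((φ.memLp 2 (μ := volume)).integrable_mul (Lp.memLp f)) (i1.add i2)
    exact eq_neg_of_add_eq_zero_left ((integral_add i1 i2).symm.trans h2)

/-- `1 - (2π)⁻² ∂²` is the Bessel potential of order two. -/
theorem besselPotential_two_eq (u : 𝓢'(ℝ, ℂ)) :
    besselPotential ℝ ℂ 2 u =
      u - ((2 * Real.pi) ^ 2 : ℂ)⁻¹ • ∂_{(1 : ℝ)} (∂_{(1 : ℝ)} u) := by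
  have hx : (fun x : ℝ => (inner ℝ x (1 : ℝ) : ℂ)).HasTemperateGrowth := by fun_prop
  have hsym : (fun x : ℝ => (((1 + ‖x‖ ^ 2) ^ ((2 : ℝ) / 2) : ℝ) : ℂ)) =
      (fun _ => 1) + (fun x : ℝ => (inner ℝ x (1 : ℝ) : ℂ)) *
        fun x : ℝ => (inner ℝ x (1 : ℝ) : ℂ) := by
    funext x
    simp [pow_two]
  rw [lineDeriv_eq_fourierMultiplierCLM, lineDeriv_eq_fourierMultiplierCLM, map_smul,
    fourierMultiplierCLM_fourierMultiplierCLM_apply hx hx, besselPotential, hsym,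
    fourierMultiplierCLM_apply, smulLeftCLM_add (by fun_prop) (hx.mul hx)]
  simp only [add_apply, smulLeftCLM_const, one_smul,
    FourierTransform.fourierInv_add, FourierTransform.fourierInv_fourier_eq,
    ← fourierMultiplierCLM_apply, smul_smul]
  rw [sub_eq_add_neg, ← neg_smul]
  congr 1
  have hπ : (Real.pi : ℂ) ≠ 0 := Complex.ofReal_ne_zero.2 Real.pi_ne_zero
  have : -(((2 * Real.pi) ^ 2 : ℂ)⁻¹ *
      (2 * Real.pi * Complex.I * (2 * Real.pi * Complex.I))) = 1 := by
    field_simp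
    simp
  rw [this, one_smul]

/-- One more order of Sobolev regularity amounts to the derivative being regular. For the converse,
`(1 - (2π)⁻² ∂²) u` has order `s - 1`, hence `u` has order `s + 1`. -/
theorem memSobolev_succ_iff (s : ℝ) (u : 𝓢'(ℝ, ℂ)) :
    MemSobolev (s + 1) 2 u ↔ MemSobolev s 2 u ∧ MemSobolev s 2 (∂_{(1 : ℝ)} u) := by
  constructor
  · intro h
    exact ⟨h.mono (by linarith), by simpa using h.lineDerivOp (m := (1 : ℝ))⟩
  · rintro ⟨h0, h1⟩
    have h2 : MemSobolev (s - 1) 2 (besselPotential ℝ ℂ 2 u) := by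
      rw [besselPotential_two_eq]
      exact (h0.mono (by linarith)).sub (h1.lineDerivOp.smul _)
    rw [memSobolev_besselPotential_iff] at h2
    convert h2 using 1
    ring

theorem mem_sobolevH_succ (n : ℕ) (f : L2) :
    f ∈ sobolevH ((n + 1 : ℕ) : ℝ) ↔ ∃ g : L2, HasWeakDeriv f g ∧ g ∈ sobolevH n := by
  have hdef : ∀ (s : ℝ) (g : L2), g ∈ sobolevH s ↔ MemSobolev s 2 (g : 𝓢'(ℝ, ℂ)) := fun _ _ =>
    Iff.rfl
  simp only [hdef, ← lineDerivOp_eq_iff_hasWeakDeriv]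
  push_cast
  constructor
  · intro h
    have h1 := ((memSobolev_succ_iff _ _).1 h).2
    obtain ⟨g, hg⟩ := memSobolev_zero_iff.1 (h1.mono n.cast_nonneg)
    exact ⟨g, hg, hg ▸ h1⟩
  · rintro ⟨g, hg, hgn⟩
    induction n generalizing f g with
    | zero =>
      refine (memSobolev_succ_iff _ _).2 ⟨?_, hg ▸ hgn⟩
      simpa using memSobolev_zero_iff.2 ⟨f, rfl⟩
    | succ n ih =>
      refine (memSobolev_succ_iff _ _).2 ⟨?_, hg ▸ hgn⟩
      push_cast at hgn ⊢
      exact ih f g hg (hgn.mono (by linarith))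

end Sobolev

/-! ### Interpolation between powers of `x` and derivatives -/

/-- A weight which is bounded for `ε > 0` and increases to `1 + x²` as `ε` decreases to `0`.
Boundedness makes all weighted norms of `L²` functions finite, so that they can be compared before
the limit is taken. -/
noncomputable def weight (ε x : ℝ) : ℝ := (1 + x ^ 2) / (1 + ε * x ^ 2)

/-- The derivative of `weight ε`. -/
noncomputable def weightDeriv (ε x : ℝ) : ℝ := 2 * x * (1 - ε) / (1 + ε * x ^ 2) ^ 2

section Weight

variable {ε : ℝ}

theorem hasDerivAt_weight (h0 : 0 < ε) (x : ℝ) : HasDerivAt (weight ε) (weightDeriv ε x) x := by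
  have hd : 1 + ε * x ^ 2 ≠ 0 := by positivity
  have h1 : HasDerivAt (fun x : ℝ => 1 + x ^ 2) (2 * x) x := by
    simpa using (hasDerivAt_pow 2 x).const_add 1
  have h2 : HasDerivAt (fun x : ℝ => 1 + ε * x ^ 2) (ε * (2 * x)) x := by
    simpa using ((hasDerivAt_pow 2 x).const_mul ε).const_add 1
  refine (h1.div h2 hd).congr_deriv ?_
  unfold weightDeriv
  congr 1
  ring

theorem continuous_weight (h0 : 0 < ε) : Continuous (weight ε) :=
  continuous_iff_continuousAt.2 fun x => (hasDerivAt_weight h0 x).continuousAt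

theorem continuous_weightDeriv (h0 : 0 < ε) : Continuous (weightDeriv ε) := by
  unfold weightDeriv
  exact Continuous.div (by fun_prop) (by fun_prop) fun x => by positivity

theorem weight_pos (h0 : 0 < ε) (x : ℝ) : 0 < weight ε x := by
  unfold weight
  positivity

theorem weight_le (h0 : 0 < ε) (x : ℝ) : weight ε x ≤ 1 + x ^ 2 :=
  div_le_self (by positivity) (by nlinarith [sq_nonneg x])

theorem weight_le_inv (h0 : 0 < ε) (h1 : ε ≤ 1) (x : ℝ) : weight ε x ≤ ε⁻¹ := by
  rw [weight, div_le_iff₀ (by positivity), inv_mul_eq_div, le_div_iff₀ h0]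
  nlinarith [sq_nonneg x]

/-- `|w'| ≤ 2 √w` uniformly in `ε`, so that differentiating the weight lowers its order. -/
theorem weightDeriv_sq_le (h0 : 0 < ε) (h1 : ε ≤ 1) (x : ℝ) :
    weightDeriv ε x ^ 2 ≤ 4 * weight ε x := by
  have hd : 1 ≤ 1 + ε * x ^ 2 := by nlinarith [sq_nonneg x]
  have h4 : (1 + ε * x ^ 2) ≤ ((1 + ε * x ^ 2) ^ 2) ^ 2 := by
    rw [← pow_mul]
    exact le_self_pow₀ hd (by norm_num)
  rw [weightDeriv, weight, div_pow, mul_div_assoc']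
  refine div_le_div₀ (by positivity) ?_ (by positivity) h4
  nlinarith [sq_nonneg x, mul_nonneg (sq_nonneg x) (mul_nonneg h0.le (by linarith : 0 ≤ 2 - ε))]

theorem tendsto_weight (x : ℝ) :
    Tendsto (fun n : ℕ => weight (1 / ((n : ℝ) + 1)) x) atTop (𝓝 (1 + x ^ 2)) := by
  have : Tendsto (fun n : ℕ => weight (1 / ((n : ℝ) + 1)) x) atTop
      (𝓝 ((1 + x ^ 2) / (1 + 0 * x ^ 2))) :=
    tendsto_const_nhds.div ((tendsto_one_div_add_atTop_nhds_zero_nat.mul_const _).const_add 1)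
      (by simp)
  simpa using this

theorem integrable_weight_pow_mul (h0 : 0 < ε) (h1 : ε ≤ 1) (n : ℕ) {f : ℝ → ℝ}
    (hf : Integrable f) : Integrable fun x => weight ε x ^ n * f x := by
  refine hf.bdd_mul (c := ε⁻¹ ^ n) ((continuous_weight h0).pow n).aestronglyMeasurable
    (Eventually.of_forall fun x => ?_)
  rw [Real.norm_eq_abs, abs_of_nonneg (pow_nonneg (weight_pos h0 x).le n)]
  exact pow_le_pow_left₀ (weight_pos h0 x).le (weight_le_inv h0 h1 x) n

theorem integrable_weight_pow_mul_complex (h0 : 0 < ε) (h1 : ε ≤ 1) (n : ℕ) {f : ℝ → ℂ}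
    (hf : Integrable f) : Integrable fun x => ((weight ε x ^ n : ℝ) : ℂ) * f x := by
  refine hf.bdd_mul (c := ε⁻¹ ^ n)
    (Complex.continuous_ofReal.comp ((continuous_weight h0).pow n)).aestronglyMeasurable
    (Eventually.of_forall fun x => ?_)
  rw [Complex.norm_real, Real.norm_eq_abs, abs_of_nonneg (pow_nonneg (weight_pos h0 x).le n)]
  exact pow_le_pow_left₀ (weight_pos h0 x).le (weight_le_inv h0 h1 x) n

theorem integrable_weightDeriv_mul_complex (h0 : 0 < ε) (h1 : ε ≤ 1) {f : ℝ → ℂ}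
    (hf : Integrable f) : Integrable fun x => (weightDeriv ε x : ℂ) * f x := by
  refine hf.bdd_mul (c := 1 + 4 * ε⁻¹)
    (Complex.continuous_ofReal.comp (continuous_weightDeriv h0)).aestronglyMeasurable
    (Eventually.of_forall fun x => ?_)
  rw [Complex.norm_real, Real.norm_eq_abs]
  have h2 := weightDeriv_sq_le h0 h1 x
  have h3 := weight_le_inv h0 h1 x
  rw [← sq_abs] at h2
  nlinarith [sq_nonneg (|weightDeriv ε x| - 1)]

end Weight

theorem integrable_mul_conj {f g : ℝ → ℂ} (hf : MemLp f 2 volume) (hg : MemLp g 2 volume) :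
    Integrable fun x => f x * conj (g x) :=
  hf.integrable_mul hg.star

/-- Young's inequality, in the form which absorbs the terms where the weight is differentiated. -/
theorem mul_le_add_of_sq_le {η r w z A B : ℝ} (hη : 0 < η) (hr : r ^ 2 ≤ 4 * w) :
    z * |r| * (A * B) ≤ η * (w * B ^ 2) + z ^ 2 / η * A ^ 2 := by
  have h1 : η * (w * B ^ 2) + z ^ 2 / η * A ^ 2 - z * |r| * (A * B) =
      η / 4 * ((4 * w - r ^ 2) * B ^ 2) + (η / 2 * (|r| * B) - z * A) ^ 2 / η := by
    rw [← sq_abs r]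
    field_simp
    ring
  have h2 : 0 ≤ (4 * w - r ^ 2) * B ^ 2 := mul_nonneg (by linarith) (sq_nonneg B)
  have h3 : 0 ≤ η / 4 * ((4 * w - r ^ 2) * B ^ 2) + (η / 2 * (|r| * B) - z * A) ^ 2 / η := by
    positivity
  linarith

/-- Convexity, up to lower order terms, of the weighted norms of successive derivatives: integrate
the derivative of `w ^ (d + 1) f f̄'`. -/
theorem weighted_norm_convexity {f₀ f₁ f₂ : ℝ → ℂ} (h₁ : HasWeakDeriv f₀ f₁)
    (h₂ : HasWeakDeriv f₁ f₂) (m₀ : MemLp f₀ 2 volume) (m₁ : MemLp f₁ 2 volume)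
    (m₂ : MemLp f₂ 2 volume) (d : ℕ) (hd : Integrable fun x => (1 + x ^ 2) ^ d * ‖f₀ x‖ ^ 2)
    {η : ℝ} (hη : 0 < η) {ε : ℝ} (h0 : 0 < ε) (h1 : ε ≤ 1) :
    ∫ x, weight ε x ^ (d + 1) * ‖f₁ x‖ ^ 2 ≤
      ((∫ x, weight ε x ^ (d + 2) * ‖f₀ x‖ ^ 2) + ∫ x, weight ε x ^ d * ‖f₂ x‖ ^ 2) / 2 +
      η * (∫ x, weight ε x ^ (d + 1) * ‖f₁ x‖ ^ 2) +
      ((d + 1 : ℝ) ^ 2 / η) * ∫ x, (1 + x ^ 2) ^ d * ‖f₀ x‖ ^ 2 := by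
  have hw : HasWeakDeriv (fun x => ((weight ε x ^ (d + 1) : ℝ) : ℂ)) fun x =>
      (((d + 1 : ℝ) * weight ε x ^ d * weightDeriv ε x : ℝ) : ℂ) := by
    refine .of_hasDerivAt (fun x => ?_) ?_
    · have := ((hasDerivAt_weight h0 x).pow (d + 1)).ofReal_comp
      simpa using this
    · have := continuous_weight h0
      have := continuous_weightDeriv h0
      fun_prop
  have i0 := integrable_weight_pow_mul h0 h1 (d + 2) m₀.integrable_sq_norm
  have i1 := integrable_weight_pow_mul h0 h1 (d + 1) m₁.integrable_sq_norm
  have i2 := integrable_weight_pow_mul h0 h1 d m₂.integrable_sq_norm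
  have hG : ∫ x, ((weight ε x ^ (d + 2) * ‖f₀ x‖ ^ 2 + weight ε x ^ d * ‖f₂ x‖ ^ 2) / 2 +
      η * (weight ε x ^ (d + 1) * ‖f₁ x‖ ^ 2) +
      ((d + 1 : ℝ) ^ 2 / η) * ((1 + x ^ 2) ^ d * ‖f₀ x‖ ^ 2)) = _ :=
    integral_add (((i0.add i2).div_const 2).add (i1.const_mul η)) (hd.const_mul _)
  have hG2 : ∫ x, ((weight ε x ^ (d + 2) * ‖f₀ x‖ ^ 2 + weight ε x ^ d * ‖f₂ x‖ ^ 2) / 2 +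
      η * (weight ε x ^ (d + 1) * ‖f₁ x‖ ^ 2)) = _ :=
    integral_add ((i0.add i2).div_const 2) (i1.const_mul η)
  have hG3 : ∫ x, (weight ε x ^ (d + 2) * ‖f₀ x‖ ^ 2 + weight ε x ^ d * ‖f₂ x‖ ^ 2) = _ :=
    integral_add i0 i2
  rw [hG2, integral_div, hG3, integral_const_mul, integral_const_mul] at hG
  rw [← hG]
  refine ((hw.mul (h₁.mul h₂.conj)).integral_le_of_le_re
    (integrable_weight_pow_mul_complex h0 h1 (d + 1) (integrable_mul_conj m₀ m₁)) ?_ i1.1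
    ((((i0.add i2).div_const 2).add (i1.const_mul η)).add (hd.const_mul _))
    (fun x => ?_) fun x => ?_).2
  · refine ((integrable_weightDeriv_mul_complex h0 h1 (integrable_weight_pow_mul_complex h0 h1 d
      ((integrable_mul_conj m₀ m₁).const_mul (d + 1 : ℂ)))).add
      (integrable_weight_pow_mul_complex h0 h1 (d + 1)
        ((integrable_mul_conj m₁ m₁).add (integrable_mul_conj m₀ m₂)))).congr
      (Eventually.of_forall fun x => ?_)
    simp only [Pi.add_apply]
    push_cast
    ring
  · exact mul_nonneg (pow_nonneg (weight_pos h0 x).le _) (sq_nonneg _)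
  · have hwp := weight_pos h0 x
    set w := weight ε x
    have e2 : -(w ^ (d + 1) * (f₀ x * conj (f₂ x)).re) ≤
        (w ^ (d + 2) * ‖f₀ x‖ ^ 2 + w ^ d * ‖f₂ x‖ ^ 2) / 2 := by
      have a1 := abs_le.1 (abs_re_mul_conj_le (f₀ x) (f₂ x))
      have a2 : w ^ (d + 1) * -(f₀ x * conj (f₂ x)).re ≤ w ^ (d + 1) * (‖f₀ x‖ * ‖f₂ x‖) := by
        gcongr
        linarith
      have a3 : 0 ≤ w ^ d * (w * ‖f₀ x‖ - ‖f₂ x‖) ^ 2 := by positivity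
      have a4 : w ^ d * (w * ‖f₀ x‖ - ‖f₂ x‖) ^ 2 = w ^ (d + 2) * ‖f₀ x‖ ^ 2 +
        w ^ d * ‖f₂ x‖ ^ 2 - 2 * (w ^ (d + 1) * (‖f₀ x‖ * ‖f₂ x‖)) := by ring
      linarith
    have e1 : -((d + 1 : ℝ) * w ^ d * weightDeriv ε x * (f₀ x * conj (f₁ x)).re) ≤
        η * (w ^ (d + 1) * ‖f₁ x‖ ^ 2) +
          (d + 1 : ℝ) ^ 2 / η * ((1 + x ^ 2) ^ d * ‖f₀ x‖ ^ 2) := by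
      have a1 := abs_re_mul_conj_le (f₀ x) (f₁ x)
      have a2 : -((d + 1 : ℝ) * w ^ d * weightDeriv ε x * (f₀ x * conj (f₁ x)).re) ≤
          w ^ d * ((d + 1 : ℝ) * |weightDeriv ε x| * (‖f₀ x‖ * ‖f₁ x‖)) := by
        refine (neg_le_abs _).trans ?_
        rw [abs_mul, abs_mul, abs_of_nonneg (by positivity : (0 : ℝ) ≤ (d + 1 : ℝ) * w ^ d)]
        calc _ ≤ (d + 1 : ℝ) * w ^ d * |weightDeriv ε x| * (‖f₀ x‖ * ‖f₁ x‖) := by gcongr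
          _ = _ := by ring
      have a3 := mul_le_add_of_sq_le (z := (d + 1 : ℝ)) hη (weightDeriv_sq_le h0 h1 x)
        (A := ‖f₀ x‖) (B := ‖f₁ x‖)
      have a4 : w ^ d * ‖f₀ x‖ ^ 2 ≤ (1 + x ^ 2) ^ d * ‖f₀ x‖ ^ 2 := by
        gcongr
        exact weight_le h0 x
      calc _ ≤ _ := a2
        _ ≤ w ^ d * (η * (w * ‖f₁ x‖ ^ 2) + (d + 1 : ℝ) ^ 2 / η * ‖f₀ x‖ ^ 2) := by gcongr
        _ = η * (w ^ (d + 1) * ‖f₁ x‖ ^ 2) + (d + 1 : ℝ) ^ 2 / η * (w ^ d * ‖f₀ x‖ ^ 2) := by ring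
        _ ≤ _ := by gcongr
    simp only [mul_add, Complex.add_re, Complex.re_ofReal_mul, Complex.mul_conj,
      Complex.ofReal_re, Complex.normSq_eq_norm_sq, Pi.add_apply]
    linarith

/-- A family of finite sequences which are convex up to small errors is bounded uniformly if its
end terms are. -/
theorem bounded_of_almost_convex {I : ℕ → ℕ → ℝ} {N : ℕ} (h0 : ∃ C, ∀ j, I j 0 ≤ C)
    (hN : ∃ C, ∀ j, I j N ≤ C)
    (hc : ∀ c, c + 2 ≤ N → ∀ η > 0, ∃ C, ∀ j,
      I j (c + 1) ≤ (I j c + I j (c + 2)) / 2 + η * I j (c + 1) + C) :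
    ∀ b ≤ N, ∃ C, ∀ j, I j b ≤ C := by
  have step : ∀ b < N, ∃ θ C : ℝ, 0 ≤ θ ∧ θ < 1 ∧ ∀ j, I j b ≤ θ * I j (b + 1) + C := by
    intro b
    induction b with
    | zero =>
      intro _
      obtain ⟨C, hC⟩ := h0
      exact ⟨0, C, le_rfl, one_pos, fun j => by simpa using hC j⟩
    | succ c ih =>
      intro hb
      obtain ⟨θ, C, hθ0, hθ1, hC⟩ := ih (by omega)
      obtain ⟨C', hC'⟩ := hc c (by omega) ((1 - θ) / 4) (by linarith)
      -- the two bounds give `(3 - θ) / 4 * I (c + 1) ≤ I (c + 2) / 2 + const`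
      have hD : 0 < 3 - θ := by linarith
      refine ⟨2 / (3 - θ), (2 * C + 4 * C') / (3 - θ), by positivity,
        by rw [div_lt_one hD]; linarith, fun j => ?_⟩
      have h1 := hC j
      have h2 := hC' j
      rw [show c + 1 + 1 = c + 2 from rfl, div_mul_eq_mul_div, ← add_div, le_div_iff₀ hD]
      linarith
  have down : ∀ m b, b + m = N → ∃ C, ∀ j, I j b ≤ C := by
    intro m
    induction m with
    | zero =>
      intro b hb
      exact (show b = N from hb) ▸ hN
    | succ m ih =>
      intro b hb
      obtain ⟨C, hC⟩ := ih (b + 1) (by omega)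
      obtain ⟨θ, C', hθ0, -, h⟩ := step b (by omega)
      exact ⟨θ * C + C', fun j => (h j).trans (by gcongr; exact hC j)⟩
  exact fun b hb => down (N - b) b (by omega)

theorem integrable_one_add_sq_pow_mul {n : ℕ} {f : ℝ → ℂ} (hf : MemLp f 2 volume)
    (h : MemLp (fun x : ℝ => (x : ℂ) ^ n * f x) 2 volume) :
    Integrable fun x : ℝ => (1 + x ^ 2) ^ n * ‖f x‖ ^ 2 := by
  refine ((hf.integrable_sq_norm.add h.integrable_sq_norm).const_mul (2 ^ n)).mono'
    ((Continuous.aestronglyMeasurable (by fun_prop)).mul (hf.1.norm.pow 2))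
    (Eventually.of_forall fun x => ?_)
  have h1 : (1 + x ^ 2) ^ n ≤ 2 ^ n * (1 + (x ^ 2) ^ n) := by
    have hp : 0 ≤ (x ^ 2) ^ n := by positivity
    rcases le_total (x ^ 2) 1 with h | h
    · calc (1 + x ^ 2) ^ n ≤ 2 ^ n := by gcongr; linarith
        _ ≤ _ := le_mul_of_one_le_right (by positivity) (by linarith)
    · calc (1 + x ^ 2) ^ n ≤ (2 * x ^ 2) ^ n := by gcongr; linarith
        _ = 2 ^ n * (x ^ 2) ^ n := mul_pow ..
        _ ≤ _ := by gcongr; linarith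
  rw [Real.norm_eq_abs, abs_of_nonneg (by positivity)]
  simp only [Pi.add_apply, norm_mul, norm_pow, Complex.norm_real, Real.norm_eq_abs]
  calc (1 + x ^ 2) ^ n * ‖f x‖ ^ 2 ≤ 2 ^ n * (1 + (x ^ 2) ^ n) * ‖f x‖ ^ 2 := by gcongr
    _ = 2 ^ n * (‖f x‖ ^ 2 + (|x| ^ n * ‖f x‖) ^ 2) := by
      rw [← sq_abs x]
      ring

/-- Interpolation: if `f, f', …, f⁽ⁿ⁾` and `xⁿ f` are in `L²`, then so are all `xᵃ f⁽ᵇ⁾` with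
`a + b ≤ n`. -/
theorem integrable_one_add_sq_pow_mul_of_add_le (n : ℕ) {F : ℕ → ℝ → ℂ}
    (hF : ∀ j < n, HasWeakDeriv (F j) (F (j + 1))) (hm : ∀ j ≤ n, MemLp (F j) 2 volume)
    (hx : MemLp (fun x : ℝ => (x : ℂ) ^ n * F 0 x) 2 volume) (a b : ℕ) (hab : a + b ≤ n) :
    Integrable fun x : ℝ => (1 + x ^ 2) ^ a * ‖F b x‖ ^ 2 := by
  induction n generalizing a b with
  | zero =>
    obtain ⟨rfl, rfl⟩ : a = 0 ∧ b = 0 := by omega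
    simpa using (hm 0 le_rfl).integrable_sq_norm
  | succ n ih =>
    -- Total order at most `n` is covered by induction; only `a + b = n + 1` is new.
    have lower := ih (fun j hj => hF j (by omega)) (fun j hj => hm j (by omega))
      (memLp_pow_mul_of_le n.le_succ (hm 0 (by omega)) hx)
    rcases Nat.lt_or_ge (a + b) (n + 1) with h | h
    · exact lower a b (by omega)
    have hε : ∀ j : ℕ, 0 < 1 / ((j : ℝ) + 1) ∧ 1 / ((j : ℝ) + 1) ≤ 1 := fun j =>
      ⟨by positivity, by rw [div_le_one (by positivity)]; linarith [j.cast_nonneg (α := ℝ)]⟩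
    have top : Integrable fun x : ℝ => (1 + x ^ 2) ^ (n + 1) * ‖F 0 x‖ ^ 2 :=
      integrable_one_add_sq_pow_mul (hm 0 (by omega)) hx
    obtain ⟨C, hC⟩ := bounded_of_almost_convex
      (I := fun j b => ∫ x, weight (1 / ((j : ℝ) + 1)) x ^ (n + 1 - b) * ‖F b x‖ ^ 2) (N := n + 1)
      ⟨∫ x, (1 + x ^ 2) ^ (n + 1) * ‖F 0 x‖ ^ 2, fun j => by
        refine integral_mono (integrable_weight_pow_mul (hε j).1 (hε j).2 _
          (hm 0 (by omega)).integrable_sq_norm) top fun x => ?_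
        have := (weight_pos (hε j).1 x).le
        have := weight_le (hε j).1 x
        dsimp only
        rw [Nat.sub_zero]
        gcongr⟩
      ⟨∫ x, ‖F (n + 1) x‖ ^ 2, fun j => by simp⟩
      (fun c hc η hη => by
        obtain ⟨d, hd⟩ : ∃ d, n + 1 = c + d + 2 := ⟨n - 1 - c, by omega⟩
        refine ⟨((d + 1 : ℝ) ^ 2 / η) * ∫ x, (1 + x ^ 2) ^ d * ‖F c x‖ ^ 2, fun j => ?_⟩
        have := weighted_norm_convexity (hF c (by omega)) (hF (c + 1) (by omega))
          (hm c (by omega)) (hm (c + 1) (by omega)) (hm (c + 2) (by omega)) d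
          (lower d c (by omega)) hη (hε j).1 (hε j).2
        rw [show n + 1 - (c + 1) = d + 1 by omega, show n + 1 - c = d + 2 by omega,
          show n + 1 - (c + 2) = d by omega]
        exact this) b (by omega)
    rw [show a = n + 1 - b by omega]
    exact integrable_of_tendsto_of_integral_le
      (fun j x => mul_nonneg (pow_nonneg (weight_pos (hε j).1 x).le _) (sq_nonneg _))
      (fun j => integrable_weight_pow_mul (hε j).1 (hε j).2 _ (hm b (by omega)).integrable_sq_norm)
      hC fun x => ((tendsto_weight x).pow _).mul_const _

/-- By the product rule, every product of factors `x` and `d/dx` is a combination of the operators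
`xᵃ (d/dx)ᵇ`, so it suffices to control the functions `xᵃ f⁽ᵇ⁾`. -/
theorem weightedSobolev_of_memLp {n : ℕ} {F : ℕ → ℝ → ℂ}
    (hF : ∀ j < n, HasWeakDeriv (F j) (F (j + 1)))
    (h : ∀ a b, a + b ≤ n → MemLp (fun x : ℝ => (x : ℂ) ^ a * F b x) 2 volume) (m a b : ℕ)
    (hab : a + b + m ≤ n) : WeightedSobolev m fun x => (x : ℂ) ^ a * F b x := by
  induction m generalizing a b with
  | zero => exact h a b hab
  | succ m ih =>
    have hpow : HasWeakDeriv (fun x : ℝ => (x : ℂ) ^ a) fun x => (a : ℂ) * (x : ℂ) ^ (a - 1) := by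
      refine .of_hasDerivAt (fun x => ?_) (by fun_prop)
      simpa using
        ((hasDerivAt_pow a x).ofReal_comp : HasDerivAt (fun x : ℝ => ((x ^ a : ℝ) : ℂ)) _ x)
    refine ⟨ih a b (by omega), ?_, _, hpow.mul (hF b (by omega)), ?_⟩
    · simpa only [pow_succ', mul_assoc] using ih (a + 1) b (by omega)
    · simpa only [mul_assoc] using
        ((ih (a - 1) b (by omega)).const_mul a).add (ih a (b + 1) (by omega))

/-! ### Comparison of the domains -/

/-- Members `f` of `H ^ n` have `n` successive weak derivatives in `L²`. -/
theorem exists_weakDerivs_of_mem_sobolevH (n : ℕ) (f : L2) (hf : f ∈ sobolevH n) :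
    ∃ F : ℕ → ℝ → ℂ, F 0 = f ∧ (∀ j < n, HasWeakDeriv (F j) (F (j + 1))) ∧
      ∀ j ≤ n, MemLp (F j) 2 volume := by
  induction n generalizing f with
  | zero =>
    refine ⟨fun _ => f, rfl, fun j hj => absurd hj (Nat.not_lt_zero j), fun j _ => Lp.memLp f⟩
  | succ n ih =>
    obtain ⟨g, hg, hgn⟩ := (mem_sobolevH_succ n f).1 hf
    obtain ⟨F, hF0, hF, hm⟩ := ih g hgn
    refine ⟨fun | 0 => f | j + 1 => F j, rfl, fun j hj => ?_, fun j hj => ?_⟩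
    · cases j with
      | zero =>
        change HasWeakDeriv f (F 0)
        rwa [hF0]
      | succ j => exact hF j (by omega)
    · cases j with
      | zero => exact Lp.memLp f
      | succ j => exact hm j (by omega)

theorem WeightedSobolev.mem_sobolevH {n : ℕ} {f : L2} (hf : WeightedSobolev n f) :
    f ∈ sobolevH n := by
  induction n generalizing f with
  | zero =>
    change TemperedDistribution.MemSobolev _ 2 _
    simpa using TemperedDistribution.memSobolev_zero_iff.2 ⟨f, rfl⟩
  | succ n ih =>
    obtain ⟨-, -, f', h, hf'⟩ := hf
    have he := hf'.memLp.coeFn_toLp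
    exact (mem_sobolevH_succ n f).2 ⟨hf'.memLp.toLp, h.congr EventuallyEq.rfl he.symm,
      ih (hf'.congr he.symm)⟩

theorem WeightedSobolev.memLp_pow_mul {n : ℕ} {f : ℝ → ℂ} (hf : WeightedSobolev n f) :
    MemLp (fun x : ℝ => (x : ℂ) ^ n * f x) 2 volume := by
  induction n generalizing f with
  | zero => simpa using hf.memLp
  | succ n ih => simpa only [pow_succ, mul_assoc] using ih hf.id_mul

/-- A square integrable function has weighted Sobolev order `n` if and only if it lies in `H ^ n`
and in the domain of multiplication by `x ^ n`. -/
theorem weightedSobolev_iff (n : ℕ) (f : L2) :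
    WeightedSobolev n f ↔ f ∈ sobolevH n ∧ MemLp (fun x : ℝ => (x : ℂ) ^ n * f x) 2 volume := by
  refine ⟨fun h => ⟨h.mem_sobolevH, h.memLp_pow_mul⟩, fun ⟨h, hx⟩ => ?_⟩
  obtain ⟨F, hF0, hF, hm⟩ := exists_weakDerivs_of_mem_sobolevH n f h
  rw [← hF0] at hx ⊢
  simpa using weightedSobolev_of_memLp hF (fun a b hab => by
    have hb := hm b (by omega)
    refine memLp_two_of_integrable_sum
      ((Complex.continuous_ofReal.pow a).aestronglyMeasurable.mul hb.1)
      (integrable_one_add_sq_pow_mul_of_add_le n hF hm hx a b hab) fun x => ?_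
    simp only [norm_mul, norm_pow, Complex.norm_real, Real.norm_eq_abs, mul_pow]
    rw [← pow_mul, mul_comm a, pow_mul, sq_abs]
    gcongr
    linarith) n 0 0 (by omega)

end HarmonicOscillator

theorem mainTheorem3 (k : ℕ) (hk : 1 ≤ k) :
    (HarmonicOscillator.powOp HarmonicOscillator.opHO k).domain =
      HarmonicOscillator.sobolevH (2 * (k : ℝ)) ⊓
        (HarmonicOscillator.powOp HarmonicOscillator.opX (2 * k)).domain := by
  ext f
  rw [Submodule.mem_inf, HarmonicOscillator.mem_powOp_opHO_domain,
    HarmonicOscillator.mem_powOp_opX_domain, HarmonicOscillator.weightedSobolev_iff]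
  push_cast
  rfl
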